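/- Let $m,n\ge 0$ be integers and put $N=m+2n$. Let $z_n$ be the standard nilpotent $N\times N$ matrix of Jordan type $(m+n,n)$ (blocks of sizes $m+n$ and $n$, in this order, ones on the superdiagonal of each block), and let $$S_n=\Big\{\,z_n+\sum_{1\le k\le N}a_k\,e_{m+n,k}+\sum_{k\in\{1,\dots,n,\,m+n+1,\dots,N\}}b_k\,e_{N,k}\Big\}\cap\mathfrak{sl}_N$$ be the Mirković–Vybornov slice, where $e_{p,q}$ are the matrix units and $a_k,b_k\in\mathbb{C}$. Let $\mathcal B_n$ be the variety of complete flags $0=V_0\subset V_1\subset\cdots\subset V_N=\mathbb C^N$, and $T^*\mathcal B_n=\{(V_\bullet,x): x\in\mathfrak{sl}_N,\ xV_j\subset V_{j-1}\ \forall j\}$. Define the (scheme-theoretic) varieties over $\mathbb{C}$ $$U_n=S_n\times_{\mathfrak{sl}_N}T^*\mathcal B_n=\{(V_\bullet,x): x\in S_n,\ xV_j\subset V_{j-1}\ \forall j\},$$ $$X_{n,i}=\{(V_\bullet,x)\in U_n: xV_{i+1}\subset V_{i-1}\}\subset U_n\qquad(0<i<N).$$ Then: 1. $U_n$ is smooth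 over $\mathbb C$. 2. For every $0<i<N$, $X_{n,i}$ is a (possibly empty) smooth divisor in $U_n$: locally on $U_n$ it is the closed subscheme $f=0$ of a single function $f$ whose differential is nonzero at every point of $X_{n,i}$. 3. For $0<i,j<N$ with $i\ne j$, $X_{n,i}$ and $X_{n,j}$ intersect transversely in $U_n$: at every point $p\in X_{n,i}\cap X_{n,j}$ one has $T_pX_{n,i}+T_pX_{n,j}=T_pU_n$. -/

import Mathlib

open CategoryTheory Matrix
open scoped TensorProduct

/-! ## Schemes over `ℂ` as functors of points

A scheme over `ℂ` is identified with the functor `R ↦ X(R)` that it defines on commutative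
`ℂ`-algebras. By the Yoneda lemma a morphism `Spec A ⟶ F` is an element `ξ ∈ F(A)`; on `R`-points
it sends `φ : A ⟶ R` to `F.map φ ξ`. -/

namespace PointFunctor

variable (F : CommAlgCat.{0} ℂ ⥤ Type)

/-- The morphism `Spec A ⟶ F` given by `ξ ∈ F(A)` is an open immersion: it is injective on
`R`-points, and for every `η ∈ F(R)`, i.e. every morphism `Spec R ⟶ F`, the preimage of `Spec A`
is the open subscheme `Spec R ∖ V(I)` for some ideal `I` of `R`. Here `ψ : R ⟶ R'` corresponds to
a morphism `Spec R' ⟶ Spec R`, which factors through `Spec R ∖ V(I)` iff `I R' = R'`. -/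
def IsOpenChart (A : CommAlgCat.{0} ℂ) (ξ : F.obj A) : Prop :=
  (∀ R : CommAlgCat.{0} ℂ, Function.Injective fun φ : A ⟶ R => F.map φ ξ) ∧
  ∀ (R : CommAlgCat.{0} ℂ) (η : F.obj R), ∃ I : Ideal R,
    ∀ (R' : CommAlgCat.{0} ℂ) (ψ : R ⟶ R'),
      (∃ φ : A ⟶ R', F.map φ ξ = F.map ψ η) ↔ I.map ψ.hom = ⊤

/-- `F` is smooth over `ℂ`: it is covered by open affine subschemes `Spec A` with `A` a smooth
`ℂ`-algebra (every point of `F` with values in a field lies in such a chart). -/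
def IsSmooth : Prop :=
  ∀ K : CommAlgCat.{0} ℂ, IsField K → ∀ p : F.obj K,
    ∃ (A : CommAlgCat.{0} ℂ) (ξ : F.obj A), IsOpenChart F A ξ ∧ Algebra.Smooth ℂ A ∧
      ∃ φ : A ⟶ K, F.map φ ξ = p

/-- The Zariski tangent space of `Spec A` at the `ℂ`-point `a`: the derivations `A → ℂ` at `a`. -/
def tangentSpace {A : CommAlgCat.{0} ℂ} (a : A ⟶ CommAlgCat.of ℂ ℂ) :
    Submodule ℂ (A →ₗ[ℂ] ℂ) where
  carrier := {D | ∀ f g : A, D (f * g) = a.hom f * D g + a.hom g * D f}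
  add_mem' {D E} hD hE f g := by
    simp only [Set.mem_ofPred_eq] at hD hE
    simp only [LinearMap.add_apply, hD f g, hE f g]; ring
  zero_mem' f g := by simp
  smul_mem' c D hD f g := by
    simp only [Set.mem_ofPred_eq] at hD
    simp only [LinearMap.smul_apply, hD f g, smul_eq_mul]; ring

variable {F}

/-- For a chart `ξ : Spec A ⟶ F`, a `ℂ`-point `a` of the chart, and a closed subscheme `X` of `F`
through `a`: the set of those tangent vectors `D` at `a` that are tangent to `X`, i.e. such that
the `ℂ[ε]`-point `f ↦ a(f) + ε D(f)` of the chart lies in `X`. -/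
def tangentVectors {A : CommAlgCat.{0} ℂ} (ξ : F.obj A) (a : A ⟶ CommAlgCat.of ℂ ℂ)
    (X : Subfunctor F) : Set (A →ₗ[ℂ] ℂ) :=
  {D | D ∈ tangentSpace a ∧ ∃ φ : A ⟶ CommAlgCat.of ℂ (DualNumber ℂ),
    (∀ f : A, φ.hom f = TrivSqZeroExt.inl (a.hom f) + TrivSqZeroExt.inr (D f)) ∧
    F.map φ ξ ∈ X.obj (CommAlgCat.of ℂ (DualNumber ℂ))}

/-- `X` is a smooth divisor in `F`: each point of `F` has a smooth affine open neighbourhood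
`Spec A` in which `X` is the closed subscheme `f = 0` of one function `f`, whose differential does
not vanish at any point of `X`. -/
def IsSmoothDivisor (X : Subfunctor F) : Prop :=
  ∀ K : CommAlgCat.{0} ℂ, IsField K → ∀ p : F.obj K,
    ∃ (A : CommAlgCat.{0} ℂ) (ξ : F.obj A), IsOpenChart F A ξ ∧ Algebra.Smooth ℂ A ∧
      (∃ φ : A ⟶ K, F.map φ ξ = p) ∧
      ∃ f : A,
        (∀ (R : CommAlgCat.{0} ℂ) (φ : A ⟶ R), F.map φ ξ ∈ X.obj R ↔ φ.hom f = 0) ∧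
        ∀ a : A ⟶ CommAlgCat.of ℂ ℂ, a.hom f = 0 → ∃ D ∈ tangentSpace a, D f ≠ 0

/-- `X` and `Y` intersect transversely in `F`: at every `ℂ`-point `a` of `X ∩ Y` (in any affine
open chart of `F`), `T_a X + T_a Y = T_a F`. -/
def IntersectTransversely (X Y : Subfunctor F) : Prop :=
  ∀ (A : CommAlgCat.{0} ℂ) (ξ : F.obj A), IsOpenChart F A ξ →
    ∀ a : A ⟶ CommAlgCat.of ℂ ℂ,
      F.map a ξ ∈ X.obj (CommAlgCat.of ℂ ℂ) → F.map a ξ ∈ Y.obj (CommAlgCat.of ℂ ℂ) →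
      ∀ D ∈ tangentSpace a, ∃ D₁ ∈ tangentVectors ξ a X, ∃ D₂ ∈ tangentVectors ξ a Y,
        D₁ + D₂ = D

end PointFunctor

/-! ## Base change of submodules of `R ^ N` -/

namespace TwoBlock

section BaseChange

variable {N : ℕ} {A B C : Type} [CommRing A] [CommRing B] [CommRing C]

/-- The submodule of `B ^ N` generated by the image of a submodule of `A ^ N`. -/
def mapSubmodule (φ : A →+* B) (V : Submodule A (Fin N → A)) : Submodule B (Fin N → B) :=
  Submodule.span B ((fun v => φ ∘ v) '' (V : Set (Fin N → A)))

theorem mapSubmodule_mono (φ : A →+* B) {V W : Submodule A (Fin N → A)} (h : V ≤ W) :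
    mapSubmodule φ V ≤ mapSubmodule φ W :=
  Submodule.span_mono (Set.image_mono h)

theorem comp_mem_mapSubmodule (φ : A →+* B) {V : Submodule A (Fin N → A)} {v : Fin N → A}
    (hv : v ∈ V) : φ ∘ v ∈ mapSubmodule φ V :=
  Submodule.subset_span ⟨v, hv, rfl⟩

theorem mapSubmodule_id (V : Submodule A (Fin N → A)) : mapSubmodule (RingHom.id A) V = V := by
  have : (fun v : Fin N → A => (RingHom.id A) ∘ v) = id := rfl
  rw [mapSubmodule, this, Set.image_id, Submodule.span_eq]

theorem mapSubmodule_comp (φ : A →+* B) (ψ : B →+* C) (V : Submodule A (Fin N → A)) :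
    mapSubmodule (ψ.comp φ) V = mapSubmodule ψ (mapSubmodule φ V) := by
  apply le_antisymm
  · refine Submodule.span_le.2 ?_
    rintro _ ⟨v, hv, rfl⟩
    exact comp_mem_mapSubmodule ψ (comp_mem_mapSubmodule φ hv)
  · refine Submodule.span_le.2 ?_
    rintro _ ⟨w, hw, rfl⟩
    simp only [SetLike.mem_coe]
    induction hw using Submodule.span_induction with
    | mem x hx =>
      obtain ⟨v, hv, rfl⟩ := hx
      exact comp_mem_mapSubmodule (ψ.comp φ) hv
    | zero => convert Submodule.zero_mem _; ext; simp
    | add x y _ _ hx hy => convert Submodule.add_mem _ hx hy; ext; simp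
    | smul b x _ hx => convert Submodule.smul_mem _ (ψ b) hx; ext; simp

/-- If `x V ⊆ W` for a matrix `x` over `A`, then the same holds after base change to `B`. -/
theorem mulVec_mem_mapSubmodule (φ : A →+* B) {V W : Submodule A (Fin N → A)}
    {x : Matrix (Fin N) (Fin N) A} (h : ∀ v ∈ V, x *ᵥ v ∈ W) :
    ∀ v ∈ mapSubmodule φ V, (x.map φ) *ᵥ v ∈ mapSubmodule φ W := by
  intro v hv
  induction hv using Submodule.span_induction with
  | mem y hy =>
    obtain ⟨v, hv, rfl⟩ := hy
    convert comp_mem_mapSubmodule φ (h v hv) using 1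
    ext i
    simp [RingHom.map_mulVec]
  | zero => simp
  | add y z _ _ hy hz => rw [Matrix.mulVec_add]; exact Submodule.add_mem _ hy hz
  | smul b y _ hy => rw [Matrix.mulVec_smul]; exact Submodule.smul_mem _ b hy

theorem nonempty_quotientEquiv [Algebra A B] (V : Submodule A (Fin N → A)) :
    Nonempty ((B ⊗[A] ((Fin N → A) ⧸ V)) ≃ₗ[B]
      ((Fin N → B) ⧸ mapSubmodule (algebraMap A B) V)) := by
  let V' := mapSubmodule (algebraMap A B) V
  let e := TensorProduct.piScalarRight A B B (Fin N)
  have he : ∀ v : Fin N → A, e (1 ⊗ₜ v) = algebraMap A B ∘ v := by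
    intro v; ext i; simp [e, Algebra.smul_def]
  let c : (Fin N → A) →ₗ[A] (Fin N → B) := (Algebra.linearMap A B).compLeft (Fin N)
  have hc : ∀ v, c v = algebraMap A B ∘ v := fun v => rfl
  let f₀ : ((Fin N → A) ⧸ V) →ₗ[A] ((Fin N → B) ⧸ V') :=
    V.liftQ (V'.mkQ.restrictScalars A ∘ₗ c) (by
      intro v hv
      simp only [LinearMap.mem_ker, LinearMap.comp_apply, hc]
      exact (Submodule.Quotient.mk_eq_zero _).2 (comp_mem_mapSubmodule _ hv))
  let f : (B ⊗[A] ((Fin N → A) ⧸ V)) →ₗ[B] ((Fin N → B) ⧸ V') :=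
    TensorProduct.AlgebraTensorModule.lift
      ((LinearMap.toSpanSingleton B (((Fin N → A) ⧸ V) →ₗ[A] ((Fin N → B) ⧸ V')) f₀))
  have hf : ∀ (b : B) (v : Fin N → A),
      f (b ⊗ₜ V.mkQ v) = b • V'.mkQ (algebraMap A B ∘ v) := fun b v => rfl
  let g : ((Fin N → B) ⧸ V') →ₗ[B] (B ⊗[A] ((Fin N → A) ⧸ V)) :=
    V'.liftQ (V.mkQ.baseChange B ∘ₗ e.symm.toLinearMap) (by
      refine Submodule.span_le.2 ?_
      rintro _ ⟨v, hv, rfl⟩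
      simp only [SetLike.mem_coe, LinearMap.mem_ker, LinearMap.comp_apply]
      rw [← he v]
      have : V.mkQ v = 0 := (Submodule.Quotient.mk_eq_zero _).2 hv
      simp [-Submodule.mkQ_apply, this])
  have hg : ∀ v : Fin N → A, g (V'.mkQ (algebraMap A B ∘ v)) = 1 ⊗ₜ V.mkQ v := by
    intro v
    change V.mkQ.baseChange B (e.symm (algebraMap A B ∘ v)) = _
    rw [← he v]; simp
  refine ⟨LinearEquiv.ofLinearMap f g ?_ ?_⟩
  · apply LinearMap.ext
    intro q
    obtain ⟨w, rfl⟩ := V'.mkQ_surjective q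
    obtain ⟨t, rfl⟩ := e.surjective w
    induction t with
    | zero => simp
    | add s t hs ht => simp only [map_add, hs, ht]
    | tmul b v =>
      have : e (b ⊗ₜ v) = b • (algebraMap A B ∘ v) := by
        rw [← he v, ← map_smul, TensorProduct.smul_tmul', smul_eq_mul, mul_one]
      rw [this, map_smul, map_smul]
      simp only [LinearMap.comp_apply, hg, hf, one_smul, LinearMap.id_apply]
  · apply LinearMap.ext
    intro t
    induction t with
    | zero => simp
    | add s t hs ht => simp only [map_add, hs, ht]
    | tmul b q =>
      obtain ⟨v, rfl⟩ := V.mkQ_surjective q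
      rw [LinearMap.comp_apply, hf, map_smul, hg, TensorProduct.smul_tmul', smul_eq_mul, mul_one]
      rfl

/-- Base change of a submodule of `A ^ N` with projective quotient of constant rank `k`. -/
def mapGrassmannian (φ : A →+* B) {k : ℕ} (V : Module.Grassmannian A (Fin N → A) k) :
    Module.Grassmannian B (Fin N → B) k where
  toSubmodule := mapSubmodule φ V.toSubmodule
  finite_quotient := inferInstance
  projective_quotient := by
    let := φ.toAlgebra
    obtain ⟨e⟩ := nonempty_quotientEquiv (B := B) V.toSubmodule
    exact Module.Projective.of_equiv e
  rankAtStalk_eq p := by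
    let := φ.toAlgebra
    obtain ⟨e⟩ := nonempty_quotientEquiv (B := B) V.toSubmodule
    have h := congrArg (fun g => g p) (Module.rankAtStalk_eq_of_equiv e)
    have h' := Module.rankAtStalk_baseChange (R := A) (S := B)
      (M := (Fin N → A) ⧸ V.toSubmodule) p
    exact h.symm.trans (h'.trans (V.rankAtStalk_eq _))

end BaseChange

/-! ## Flags, the cotangent bundle, and the slice -/

/-- A complete flag `0 = V₀ ⊆ V₁ ⊆ ⋯ ⊆ V_N = R ^ N` over a commutative ring `R`, i.e. an `R`-point
of the flag variety of `GL_N`: `R ^ N / V_i` is projective of constant rank `N - i`, so that `V_i`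
is a direct summand of rank `i`. -/
@[ext]
structure Flag (N : ℕ) (R : Type) [CommRing R] where
  V : ∀ i : Fin (N + 1), Module.Grassmannian R (Fin N → R) (N - i)
  mono : ∀ i j, i ≤ j → (V i).toSubmodule ≤ (V j).toSubmodule

/-- Base change of flags. -/
def Flag.map {N : ℕ} {A B : Type} [CommRing A] [CommRing B] (φ : A →+* B) (V : Flag N A) :
    Flag N B where
  V i := mapGrassmannian φ (V.V i)
  mono i j h := mapSubmodule_mono φ (V.mono i j h)

theorem Flag.map_id {N : ℕ} {A : Type} [CommRing A] (V : Flag N A) :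
    V.map (RingHom.id A) = V :=
  Flag.ext (funext fun _ => Module.Grassmannian.ext (mapSubmodule_id _))

theorem Flag.map_comp {N : ℕ} {A B C : Type} [CommRing A] [CommRing B] [CommRing C]
    (φ : A →+* B) (ψ : B →+* C) (V : Flag N A) : V.map (ψ.comp φ) = (V.map φ).map ψ :=
  Flag.ext (funext fun _ => Module.Grassmannian.ext (mapSubmodule_comp φ ψ _))

/-- The product of the flag variety of `GL_N` with the affine space of `N × N` matrices. -/
def flagMat (N : ℕ) : CommAlgCat.{0} ℂ ⥤ Type where
  obj R := Flag N R × Matrix (Fin N) (Fin N) R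
  map {R R'} φ := TypeCat.ofHom fun p : Flag N R × Matrix (Fin N) (Fin N) R =>
    ((p.1.map (φ.hom : R →+* R'), p.2.map φ.hom) : Flag N R' × Matrix (Fin N) (Fin N) R')
  map_id R := by
    apply ConcreteCategory.hom_ext
    intro p
    exact Prod.ext (Flag.map_id p.1) rfl
  map_comp {R R' R''} φ ψ := by
    apply ConcreteCategory.hom_ext
    intro p
    exact Prod.ext (Flag.map_comp (φ.hom : R →+* R') (ψ.hom : R' →+* R'') p.1) rfl

/-- The cotangent bundle `T^* B` of the flag variety: pairs `(V, x)` with `tr x = 0` and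
`x V_j ⊆ V_{j-1}` for all `j`. -/
def cotangentBundle (N : ℕ) : Subfunctor (flagMat N) where
  obj R := {p : Flag N R × Matrix (Fin N) (Fin N) R | p.2.trace = 0 ∧
    ∀ j k : Fin (N + 1), (j : ℕ) = k + 1 →
      ∀ v ∈ (p.1.V j).toSubmodule, p.2 *ᵥ v ∈ (p.1.V k).toSubmodule}
  map {R R'} φ := by
    rintro p ⟨htr, hp⟩
    refine ⟨?_, fun j k hjk => mulVec_mem_mapSubmodule (φ.hom : R →+* R') (hp j k hjk)⟩
    have := congrArg φ.hom htr
    rw [AddMonoidHom.map_trace, map_zero] at this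
    exact this

/-- The standard nilpotent matrix of Jordan type `(m + n, n)`: with 1-based indices,
`z e_{k+1} = e_k` for `k ≠ m + n`, and `z e_1 = z e_{m+n+1} = 0`. -/
def standardNilpotent (m n : ℕ) (R : Type) [CommRing R] :
    Matrix (Fin (m + 2 * n)) (Fin (m + 2 * n)) R :=
  Matrix.of fun p q => if (q : ℕ) = p + 1 ∧ (p : ℕ) + 1 ≠ m + n then 1 else 0

/-- The Mirković–Vybornov slice `S_n`: the traceless matrices `z + ∑ a_i e_{m+n,i} + ∑ b_i e_{m+2n,i}`,
where (1-based) `i` runs over all indices in the first sum and over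
`{1, …, n, m+n+1, …, m+2n}` in the second. In other words all entries of `x` outside these
positions agree with those of `z`, which vanishes in these positions. -/
def IsInSlice (m n : ℕ) {R : Type} [CommRing R]
    (x : Matrix (Fin (m + 2 * n)) (Fin (m + 2 * n)) R) : Prop :=
  x.trace = 0 ∧ ∀ p q : Fin (m + 2 * n),
    ¬ ((p : ℕ) + 1 = m + n) →
    ¬ ((p : ℕ) + 1 = m + 2 * n ∧ ((q : ℕ) < n ∨ m + n ≤ (q : ℕ))) →
    x p q = standardNilpotent m n R p q

/-- The preimage of `S_n` under the projection `(V, x) ↦ x`. -/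
def overSlice (m n : ℕ) : Subfunctor (flagMat (m + 2 * n)) where
  obj R := {p : Flag (m + 2 * n) R × Matrix (Fin (m + 2 * n)) (Fin (m + 2 * n)) R |
    IsInSlice m n p.2}
  map {R R'} φ := by
    rintro p ⟨htr, hp⟩
    constructor
    · have := congrArg φ.hom htr
      rw [AddMonoidHom.map_trace, map_zero] at this
      exact this
    · intro i j h₁ h₂
      have := congrArg φ.hom (hp i j h₁ h₂)
      refine Eq.trans this ?_
      simp only [standardNilpotent, Matrix.of_apply]
      split_ifs <;> simp

/-- The variety `U_n = S_n ×_{sl_{m+2n}} T^* B_n`. -/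
def U (m n : ℕ) : CommAlgCat.{0} ℂ ⥤ Type :=
  (cotangentBundle (m + 2 * n) ⊓ overSlice m n).toFunctor

/-- The closed subvariety `X_{n,i}` of `U_n` (for `0 < i < m + 2n`): the pairs `(V, x)` in `U_n`
with `x V_{i+1} ⊆ V_{i-1}`. -/
def X (m n i : ℕ) : Subfunctor (U m n) where
  obj R := {p : (cotangentBundle (m + 2 * n) ⊓ overSlice m n).toFunctor.obj R |
    ∀ j k : Fin (m + 2 * n + 1), (j : ℕ) = i + 1 → (k : ℕ) + 1 = i →
      ∀ v ∈ (p.1.1.V j).toSubmodule, p.1.2 *ᵥ v ∈ (p.1.1.V k).toSubmodule}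
  map {R R'} φ := by
    intro p hp j k hj hk
    exact mulVec_mem_mapSubmodule (φ.hom : R →+* R') (hp j k hj hk)

end TwoBlock

namespace TwoBlock

/-! ### Minors: spanning as an open condition under base change. -/

section Minors

variable {N : ℕ} {A B : Type} [CommRing A] [CommRing B]

/-! Locally, a point of `U` over any ring is a pair (g, y): the columns of g form a basis adapted to
the flag, and x = g y g⁻¹ with y strictly upper triangular. The only remaining condition is that x
lie in the slice. In these terms `X m n i` is the vanishing of a single superdiagonal entry of y
(`point_mem_X_iff`).

Everything rests on a lifting statement, `exists_point_lift`: across a square-zero extension with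
kernel J, a pair (g, y) lifts with any prescribed strictly upper triangular lift y' of y. Lift g
arbitrarily to g₁. Then g₁ y' g₁⁻¹ is in the slice only modulo J; conjugation by some 1 + ξ, with ξ
having entries in J, moves it into the slice, and 1 + ξ is absorbed into g₁. Such a ξ exists because
the slice is transverse to adjoint orbits (`exists_commutator_add_eq_zero`), which is shown by
solving for the rows of ξ recursively, over any ring.

Smoothness follows by the infinitesimal criterion. Over the dual numbers, moving only the i-th
superdiagonal entry of y by ε gives a tangent vector that is not tangent to `X m n i` but is tangent
to every other `X m n j` through the point (`exists_tangent_transverse`). This yields both the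
nonvanishing differential and transversality.

The charts come from translated big cells of the flag variety: a flag complementary to the
coordinate flag of a permutation w has a unique adapted basis in normal form
(`Flag.exists_isCellForm`, `IsCellForm.ext_of_columnSpan_eq`), so this part of `U` is represented by
the finitely presented algebra `cellAlgebra w`. Minors show that it is open, and over a field every
flag lies in some cell (`exists_perm_sup_cellComplement_eq_top`). -/

theorem mapSubmodule_top (φ : A →+* B) :
    mapSubmodule φ (⊤ : Submodule A (Fin N → A)) = ⊤ := by
  rw [eq_top_iff]
  intro v _
  rw [pi_eq_sum_univ v]
  refine Submodule.sum_mem _ fun i _ => Submodule.smul_mem _ _ ?_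
  convert comp_mem_mapSubmodule φ (Submodule.mem_top (x := Pi.single i (1 : A))) using 1
  ext j
  by_cases h : j = i
  · subst h; simp
  · simp [h, Ne.symm h]

theorem mapSubmodule_sup (φ : A →+* B) (V W : Submodule A (Fin N → A)) :
    mapSubmodule φ (V ⊔ W) = mapSubmodule φ V ⊔ mapSubmodule φ W := by
  apply le_antisymm
  · refine Submodule.span_le.2 ?_
    rintro _ ⟨u, hu, rfl⟩
    obtain ⟨v, hv, w, hw, rfl⟩ := Submodule.mem_sup.1 hu
    refine Submodule.mem_sup.2 ⟨_, comp_mem_mapSubmodule φ hv, _, comp_mem_mapSubmodule φ hw, ?_⟩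
    ext i; simp
  · exact sup_le (mapSubmodule_mono φ le_sup_left) (mapSubmodule_mono φ le_sup_right)

/-- The ideal generated by the `N × N` minors of matrices with rows in `W`. -/
def minorIdeal (W : Submodule A (Fin N → A)) : Ideal A :=
  Ideal.span {d | ∃ M : Matrix (Fin N) (Fin N) A, (∀ k, M k ∈ W) ∧ M.det = d}

/-- Cramer's rule: the adjugate expresses the multiple of v as a combination of the rows of M. -/
theorem det_smul_mem {W : Submodule A (Fin N → A)} {M : Matrix (Fin N) (Fin N) A}
    (hM : ∀ k, M k ∈ W) (v : Fin N → A) : M.det • v ∈ W := by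
  have h : M.det • v = (v ᵥ* M.adjugate) ᵥ* M := by
    rw [vecMul_vecMul, adjugate_mul, vecMul_smul, vecMul_one]
  rw [h, vecMul_eq_sum]
  exact Submodule.sum_mem _ fun k _ => Submodule.smul_mem _ _ (hM k)

theorem smul_mem_of_mem_minorIdeal {W : Submodule A (Fin N → A)} {a : A}
    (ha : a ∈ minorIdeal W) (v : Fin N → A) : a • v ∈ W := by
  induction ha using Submodule.span_induction with
  | mem x hx => obtain ⟨M, hM, rfl⟩ := hx; exact det_smul_mem hM v
  | zero => simp
  | add x y _ _ hx hy => rw [add_smul]; exact W.add_mem hx hy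
  | smul b x _ hx => rw [smul_assoc]; exact W.smul_mem _ hx

theorem exists_det_ne_zero_of_span_eq_top {K : Type} [Field K] {S : Set (Fin N → K)}
    (hS : Submodule.span K S = ⊤) :
    ∃ M : Matrix (Fin N) (Fin N) K, (∀ k, M k ∈ S) ∧ M.det ≠ 0 := by
  let b := Module.Basis.ofSpan (K := K) hS.ge
  let e := b.indexEquiv (Pi.basisFun K (Fin N))
  let c := b.reindex e
  refine ⟨Matrix.of fun k => c k, fun k => ?_, ?_⟩
  · have := Module.Basis.ofSpan_subset (K := K) hS.ge
    apply this
    exact ⟨e.symm k, by simp [c, b]; rfl⟩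
  · have hc : LinearIndependent K (Matrix.of fun k => c k).row := c.linearIndependent
    exact ((Matrix.isUnit_iff_isUnit_det _).1 (Matrix.linearIndependent_rows_iff_isUnit.1 hc)).ne_zero

/-- This supplies the ideal required by `IsOpenChart`. If the minors generate the unit ideal,
Cramer's rule applies. Conversely, if they all lay in a maximal ideal, a spanning set over its
residue field would contain a basis, whose nonzero determinant is the image of a minor. -/
theorem map_minorIdeal_eq_top_iff (φ : A →+* B) (W : Submodule A (Fin N → A)) :
    (minorIdeal W).map φ = ⊤ ↔ mapSubmodule φ W = ⊤ := by
  constructor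
  · intro h
    rw [eq_top_iff]
    intro v _
    suffices ∀ b ∈ (minorIdeal W).map φ, ∀ v, b • v ∈ mapSubmodule φ W by
      simpa using this 1 (h ▸ Submodule.mem_top) v
    intro b hb
    induction hb using Submodule.span_induction with
    | mem x hx =>
      obtain ⟨a, ha, rfl⟩ := hx
      intro v
      have hv : v ∈ mapSubmodule φ (⊤ : Submodule A (Fin N → A)) := by
        rw [mapSubmodule_top]; trivial
      induction hv using Submodule.span_induction with
      | mem x hx =>
        obtain ⟨u, -, rfl⟩ := hx
        convert comp_mem_mapSubmodule φ (smul_mem_of_mem_minorIdeal ha u) using 1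
        ext i; simp
      | zero => simp
      | add x y _ _ hx hy => rw [smul_add]; exact Submodule.add_mem _ hx hy
      | smul b x _ hx => rw [smul_comm]; exact Submodule.smul_mem _ _ hx
    | zero => simp
    | add x y _ _ hx hy => intro v; rw [add_smul]; exact Submodule.add_mem _ (hx v) (hy v)
    | smul b x _ hx => intro v; rw [smul_assoc]; exact Submodule.smul_mem _ _ (hx v)
  · intro h
    by_contra hne
    obtain ⟨q, hq, hle⟩ := Ideal.exists_le_maximal _ hne
    let := Ideal.Quotient.field q
    let π : A →+* B ⧸ q := (Ideal.Quotient.mk q).comp φ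
    have hπ : Submodule.span (B ⧸ q) ((fun v => π ∘ v) '' (W : Set (Fin N → A))) = ⊤ := by
      change mapSubmodule π W = ⊤
      rw [mapSubmodule_comp, h, mapSubmodule_top]
    obtain ⟨M, hM, hdet⟩ := exists_det_ne_zero_of_span_eq_top hπ
    choose L hL hLM using hM
    apply hdet
    have : M = π.mapMatrix (Matrix.of L) := by
      ext i j; rw [← hLM]; rfl
    rw [this, ← RingHom.map_det]
    exact Ideal.Quotient.eq_zero_iff_mem.2
      (hle (Ideal.mem_map_of_mem φ (Ideal.subset_span ⟨_, hL, rfl⟩)))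

end Minors

/-! ### Flags spanned by the columns of an invertible matrix. -/

section FlagOf

variable {N : ℕ} {A B : Type} [CommRing A] [CommRing B]

/-- The span of the first `j` columns of an invertible matrix `g`. -/
def columnSpan (g : (Matrix (Fin N) (Fin N) A)ˣ) (j : ℕ) : Submodule A (Fin N → A) where
  carrier := {v | ∀ k : Fin N, j ≤ k → ((↑g⁻¹ : Matrix (Fin N) (Fin N) A) *ᵥ v) k = 0}
  add_mem' {v w} hv hw k hk := by
    rw [mulVec_add, Pi.add_apply, hv k hk, hw k hk, add_zero]
  zero_mem' k _ := by simp
  smul_mem' c v hv k hk := by rw [mulVec_smul, Pi.smul_apply, hv k hk, smul_zero]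

theorem mem_columnSpan {g : (Matrix (Fin N) (Fin N) A)ˣ} {j : ℕ} {v : Fin N → A} :
    v ∈ columnSpan g j ↔
      ∀ k : Fin N, j ≤ k → ((↑g⁻¹ : Matrix (Fin N) (Fin N) A) *ᵥ v) k = 0 := Iff.rfl

theorem columnSpan_mono (g : (Matrix (Fin N) (Fin N) A)ˣ) : Monotone (columnSpan g) :=
  fun _ _ h _ hv k hk => hv k (h.trans hk)

theorem inv_mulVec_mulVec (g : (Matrix (Fin N) (Fin N) A)ˣ) (v : Fin N → A) :
    (↑g⁻¹ : Matrix (Fin N) (Fin N) A) *ᵥ ((g : Matrix (Fin N) (Fin N) A) *ᵥ v) = v := by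
  rw [mulVec_mulVec, Units.inv_mul, one_mulVec]

theorem mulVec_inv_mulVec (g : (Matrix (Fin N) (Fin N) A)ˣ) (v : Fin N → A) :
    (g : Matrix (Fin N) (Fin N) A) *ᵥ ((↑g⁻¹ : Matrix (Fin N) (Fin N) A) *ᵥ v) = v := by
  rw [mulVec_mulVec, Units.mul_inv, one_mulVec]

theorem col_mem_columnSpan (g : (Matrix (Fin N) (Fin N) A)ˣ) {k : Fin N} {j : ℕ}
    (h : (k : ℕ) < j) : (g : Matrix (Fin N) (Fin N) A).col k ∈ columnSpan g j := by
  intro l hl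
  rw [← mulVec_single_one, inv_mulVec_mulVec, Pi.single_eq_of_ne]
  rintro rfl; omega

theorem columnSpan_le {g : (Matrix (Fin N) (Fin N) A)ˣ} {j : ℕ} {W : Submodule A (Fin N → A)}
    (h : ∀ k : Fin N, (k : ℕ) < j → (g : Matrix (Fin N) (Fin N) A).col k ∈ W) :
    columnSpan g j ≤ W := by
  intro v hv
  rw [← mulVec_inv_mulVec g v, mulVec_eq_sum]
  refine Submodule.sum_mem _ fun k _ => ?_
  by_cases hk : j ≤ k
  · rw [hv k hk]; simp
  · rw [op_smul_eq_smul]; exact W.smul_mem _ (h k (by omega))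

/-- The complete flag spanned by the columns of an invertible matrix. -/
noncomputable def flagOf (g : (Matrix (Fin N) (Fin N) A)ˣ) : Flag N A :=
  -- The last N - j coordinates with respect to the columns of g. This surjection has kernel
  -- `columnSpan g j`, so the quotient is free of rank N - j.
  let c (j : Fin (N + 1)) : (Fin N → A) →ₗ[A] (Fin (N - j) → A) :=
    (LinearMap.funLeft A A fun k : Fin (N - j) => (⟨j + k, by omega⟩ : Fin N)) ∘ₗ
      Matrix.mulVecLin (↑g⁻¹ : Matrix (Fin N) (Fin N) A)
  have hc (j) : Function.Surjective (c j) := by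
    refine (LinearMap.funLeft_surjective_of_injective A A _ fun a b h => ?_).comp
      (f := (Matrix.mulVecLin (↑g⁻¹ : Matrix (Fin N) (Fin N) A)))
      fun v => ⟨_, inv_mulVec_mulVec g v⟩
    simpa [Fin.ext_iff] using h
  have hk (j : Fin (N + 1)) : LinearMap.ker (c j) = columnSpan g j := by
    ext v
    rw [LinearMap.mem_ker, mem_columnSpan]
    constructor
    · intro h k hk
      have := congrFun h ⟨k - j, by omega⟩
      simpa [c, LinearMap.funLeft, Nat.add_sub_cancel' hk] using this
    · intro h
      ext k
      exact h _ (by simp)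
  let e (j : Fin (N + 1)) : ((Fin N → A) ⧸ columnSpan g j) ≃ₗ[A] (Fin (N - j) → A) :=
    (Submodule.quotEquivOfEq _ _ (hk j).symm).trans ((c j).quotKerEquivOfSurjective (hc j))
  { V := fun j =>
      { toSubmodule := columnSpan g j
        finite_quotient := inferInstance
        projective_quotient := Module.Projective.of_equiv (e j).symm
        rankAtStalk_eq := fun p => by
          have := PrimeSpectrum.nontrivial p
          rw [Module.rankAtStalk_eq_of_equiv (e j)]
          simp }
    mono := fun _ _ h => columnSpan_mono g h }

/-- Base change of invertible matrices. -/
def mapUnits (φ : A →+* B) (g : (Matrix (Fin N) (Fin N) A)ˣ) : (Matrix (Fin N) (Fin N) B)ˣ :=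
  Units.map (φ.mapMatrix : Matrix (Fin N) (Fin N) A →+* Matrix (Fin N) (Fin N) B) g

theorem coe_mapUnits (φ : A →+* B) (g : (Matrix (Fin N) (Fin N) A)ˣ) :
    (mapUnits φ g : Matrix (Fin N) (Fin N) B) = (g : Matrix (Fin N) (Fin N) A).map φ := rfl

theorem coe_inv_mapUnits (φ : A →+* B) (g : (Matrix (Fin N) (Fin N) A)ˣ) :
    (↑(mapUnits φ g)⁻¹ : Matrix (Fin N) (Fin N) B) =
      (↑g⁻¹ : Matrix (Fin N) (Fin N) A).map φ := rfl

theorem mapSubmodule_columnSpan (φ : A →+* B) (g : (Matrix (Fin N) (Fin N) A)ˣ) (j : ℕ) :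
    mapSubmodule φ (columnSpan g j) = columnSpan (mapUnits φ g) j := by
  apply le_antisymm
  · refine Submodule.span_le.2 ?_
    rintro _ ⟨v, hv, rfl⟩ k hk
    rw [coe_inv_mapUnits]
    have := congrArg φ (hv k hk)
    rw [map_zero, RingHom.map_mulVec] at this
    exact this
  · exact columnSpan_le fun k hk => comp_mem_mapSubmodule φ (col_mem_columnSpan g hk)

theorem flagOf_map (φ : A →+* B) (g : (Matrix (Fin N) (Fin N) A)ˣ) :
    (flagOf g).map φ = flagOf (mapUnits φ g) :=
  Flag.ext (funext fun j => Module.Grassmannian.ext (mapSubmodule_columnSpan φ g j))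

/-- For `x = g y g⁻¹`, the inclusion `x V_j ⊆ V_k` in terms of the entries of `y`. -/
theorem conj_mulVec_mem_columnSpan_iff (g : (Matrix (Fin N) (Fin N) A)ˣ)
    (y : Matrix (Fin N) (Fin N) A) (j k : ℕ) :
    (∀ v ∈ columnSpan g j, ((g : Matrix (Fin N) (Fin N) A) * y * (↑g⁻¹ : Matrix _ _ A)) *ᵥ v ∈
      columnSpan g k) ↔ ∀ p q : Fin N, k ≤ p → (q : ℕ) < j → y p q = 0 := by
  have key (v : Fin N → A) : (↑g⁻¹ : Matrix (Fin N) (Fin N) A) *ᵥ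
      (((g : Matrix (Fin N) (Fin N) A) * y * (↑g⁻¹ : Matrix _ _ A)) *ᵥ v) =
      y *ᵥ ((↑g⁻¹ : Matrix (Fin N) (Fin N) A) *ᵥ v) := by
    rw [← mulVec_mulVec, ← mulVec_mulVec, inv_mulVec_mulVec]
  constructor
  · intro h p q hp hq
    have := h _ (col_mem_columnSpan g hq) p hp
    rw [key, ← mulVec_single_one, inv_mulVec_mulVec, mulVec_single_one] at this
    exact this
  · intro h v hv p hp
    rw [key]
    rw [mulVec, dotProduct]
    refine Finset.sum_eq_zero fun q _ => ?_
    by_cases hq : (q : ℕ) < j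
    · rw [h p q hp hq, zero_mul]
    · rw [hv q (by omega), mul_zero]

end FlagOf

/-! ### Transversality of the slice to adjoint orbits. -/

section Transversality

variable {R : Type} [CommRing R]

/-- The right-hand side at s involves γ only at indices larger than s, so the values are found
downwards from M, and each new value leaves the equations already solved intact. -/
theorem exists_backward_recurrence {ι : Type*} [Fintype ι] (J : Ideal R) (M : ℕ) (t : ℕ → R)
    (ht : ∀ s, t s ∈ J) (c : ι → R) (e : ι → ℕ) :
    ∃ γ : ℕ → R, (∀ s, γ s ∈ J) ∧ (∀ s, M ≤ s → γ s = 0) ∧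
      ∀ s, s < M → γ s = t s + ∑ k, c k * γ (s + 1 + e k) := by
  suffices ∀ d, ∃ γ : ℕ → R, (∀ s, γ s ∈ J) ∧ (∀ s, M ≤ s → γ s = 0) ∧
      ∀ s, M ≤ s + d → s < M → γ s = t s + ∑ k, c k * γ (s + 1 + e k) by
    obtain ⟨γ, h₁, h₂, h₃⟩ := this M
    exact ⟨γ, h₁, h₂, fun s hs => h₃ s (by omega) hs⟩
  intro d
  induction d with
  | zero => exact ⟨0, fun _ => J.zero_mem, fun _ _ => rfl, fun s h h' => by omega⟩
  | succ d ih =>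
    obtain ⟨γ, h₁, h₂, h₃⟩ := ih
    by_cases hd : M ≤ d
    · exact ⟨γ, h₁, h₂, fun s _ hs => h₃ s (by omega) hs⟩
    refine ⟨Function.update γ (M - d - 1)
      (t (M - d - 1) + ∑ k, c k * γ (M - d - 1 + 1 + e k)), fun s => ?_, fun s hs => ?_,
      fun s hs hs' => ?_⟩
    · by_cases h : s = M - d - 1
      · rw [h, Function.update_self]
        exact J.add_mem (ht _) (J.sum_mem fun k _ => J.mul_mem_left _ (h₁ _))
      · rw [Function.update_of_ne h]; exact h₁ s
    · rw [Function.update_of_ne (by omega)]; exact h₂ s hs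
    · have hu (k : ι) : Function.update γ (M - d - 1)
          (t (M - d - 1) + ∑ k, c k * γ (M - d - 1 + 1 + e k)) (s + 1 + e k) =
          γ (s + 1 + e k) := Function.update_of_ne (by omega) _ _
      simp only [hu]
      by_cases h : s = M - d - 1
      · rw [h, Function.update_self]
      · rw [Function.update_of_ne h]; exact h₃ s (by omega) hs'

variable {m n : ℕ}

/-- The positions at which all matrices of the slice have the same entry. -/
def IsFixedPosition (m n : ℕ) (p q : Fin (m + 2 * n)) : Prop :=
  ¬ ((p : ℕ) + 1 = m + n) ∧ ¬ ((p : ℕ) + 1 = m + 2 * n ∧ ((q : ℕ) < n ∨ m + n ≤ (q : ℕ)))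

/-- The rows of a matrix `ξ` such that `E + [ξ, x]` vanishes in all rows except those with
indices `m + n - 1` and `m + 2 n - 1`; the rows `0` and `β` of `ξ` at `0` and `m + n` are
prescribed. -/
def commutatorRow (x E : Matrix (Fin (m + 2 * n)) (Fin (m + 2 * n)) R)
    (β : Fin (m + 2 * n) → R) : ℕ → Fin (m + 2 * n) → R
  | 0 => 0
  | k + 1 => if k + 1 = m + n then β else
      commutatorRow x E β k ᵥ* x + if h : k < m + 2 * n then E ⟨k, h⟩ else 0

theorem vecMul_mem {N : ℕ} {J : Ideal R} {v : Fin N → R} (hv : ∀ i, v i ∈ J)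
    (x : Matrix (Fin N) (Fin N) R) (q : Fin N) : (v ᵥ* x) q ∈ J := by
  rw [vecMul, dotProduct]
  exact J.sum_mem fun i _ => J.mul_mem_right _ (hv i)

theorem commutatorRow_mem {J : Ideal R} {x E : Matrix (Fin (m + 2 * n)) (Fin (m + 2 * n)) R}
    (hE : ∀ p q, E p q ∈ J) {β : Fin (m + 2 * n) → R} (hβ : ∀ q, β q ∈ J) (k : ℕ)
    (q : Fin (m + 2 * n)) : commutatorRow x E β k q ∈ J := by
  induction k generalizing q with
  | zero => exact J.zero_mem
  | succ k ih =>
    rw [commutatorRow]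
    split_ifs
    · exact hβ q
    · exact J.add_mem (vecMul_mem ih x q) (hE _ _)
    · exact J.add_mem (vecMul_mem ih x q) J.zero_mem

theorem commutatorRow_of_lt (x E : Matrix (Fin (m + 2 * n)) (Fin (m + 2 * n)) R)
    (β : Fin (m + 2 * n) → R) {k : ℕ} (hk : k < m + n) :
    commutatorRow x E β k = commutatorRow x E 0 k := by
  induction k with
  | zero => rfl
  | succ k ih => rw [commutatorRow, commutatorRow, if_neg hk.ne, if_neg hk.ne, ih (by omega)]

/-- Beyond row m + n each step multiplies by x and adds a row of E, so the rows are affine in β with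
linear part β xᵏ. -/
theorem commutatorRow_add (hmn : 0 < m + n) (x E : Matrix (Fin (m + 2 * n)) (Fin (m + 2 * n)) R)
    (β : Fin (m + 2 * n) → R) (k : ℕ) :
    commutatorRow x E β (m + n + k) = β ᵥ* x ^ k + commutatorRow x E 0 (m + n + k) := by
  induction k with
  | zero =>
    obtain ⟨l, hl⟩ : ∃ l, m + n = l + 1 := ⟨m + n - 1, by omega⟩
    rw [add_zero, hl, commutatorRow, commutatorRow, if_pos hl.symm, if_pos hl.symm]
    simp
  | succ k ih =>
    rw [← add_assoc, commutatorRow, commutatorRow, if_neg (by omega), if_neg (by omega), ih,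
      add_vecMul, vecMul_vecMul, pow_succ, add_assoc]

/-- The rows j, …, j + k - 1 come before the last row of the first block, and there x is a pure
shift. -/
theorem pow_row_eq {x : Matrix (Fin (m + 2 * n)) (Fin (m + 2 * n)) R}
    (hx : ∀ p q, IsFixedPosition m n p q → x p q = standardNilpotent m n R p q)
    (j k : ℕ) (hjk : j + k < m + n) (q : Fin (m + 2 * n)) :
    (x ^ k) ⟨j, by omega⟩ q = if (q : ℕ) = j + k then 1 else 0 := by
  induction k generalizing q with
  | zero => simp [one_apply, Fin.ext_iff, eq_comm]
  | succ k ih =>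
    rw [pow_succ, mul_apply, Finset.sum_eq_single ⟨j + k, by omega⟩]
    · rw [ih (by omega), if_pos rfl, one_mul, hx _ _ ⟨by simp; omega, by simp; omega⟩]
      simp only [standardNilpotent, of_apply]
      refine if_congr ⟨fun h => by omega, fun h => by omega⟩ rfl rfl
    · intro l _ hl
      rw [ih (by omega), if_neg (fun h => hl (Fin.ext h)), zero_mul]
    · simp

/-- The slice is transverse to the adjoint orbits, over any ring. -/
theorem exists_commutator_add_eq_zero {J : Ideal R}
    {x E : Matrix (Fin (m + 2 * n)) (Fin (m + 2 * n)) R}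
    (hx : ∀ p q, IsFixedPosition m n p q → x p q = standardNilpotent m n R p q)
    (hE : ∀ p q, E p q ∈ J) :
    ∃ ξ : Matrix (Fin (m + 2 * n)) (Fin (m + 2 * n)) R, (∀ p q, ξ p q ∈ J) ∧
      ∀ p q, IsFixedPosition m n p q → (E + ξ * x - x * ξ) p q = 0 := by
  have hrow (ξ : Matrix (Fin (m + 2 * n)) (Fin (m + 2 * n)) R) (p q : Fin (m + 2 * n)) :
      (E + ξ * x - x * ξ) p q = E p q + (ξ p ᵥ* x) q - (x p ᵥ* ξ) q := rfl
  -- Row p of x is the unit vector at p + 1, so row p of x ξ is row p + 1 of ξ, and the required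
  -- vanishing is the recursion defining `commutatorRow`.
  have hinner (β : Fin (m + 2 * n) → R) (p q : Fin (m + 2 * n)) (h₁ : (p : ℕ) + 1 ≠ m + n)
      (h₂ : (p : ℕ) + 1 ≠ m + 2 * n) :
      (E + Matrix.of (fun k : Fin (m + 2 * n) => commutatorRow x E β k) * x -
        x * Matrix.of (fun k : Fin (m + 2 * n) => commutatorRow x E β k)) p q = 0 := by
    rw [hrow]
    have hp : (x p ᵥ* Matrix.of fun k : Fin (m + 2 * n) => commutatorRow x E β k) q =
        commutatorRow x E β (p + 1) q := by
      rw [vecMul, dotProduct, Finset.sum_eq_single ⟨p + 1, by omega⟩]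
      · rw [hx _ _ ⟨h₁, fun h => h₂ h.1⟩]
        simp [standardNilpotent, h₁]
      · intro l _ hl
        rw [hx _ _ ⟨h₁, fun h => h₂ h.1⟩]
        have : (l : ℕ) ≠ p + 1 := fun h => hl (Fin.ext h)
        simp [standardNilpotent, this]
      · simp
    rw [hp, commutatorRow, if_neg h₁, dif_pos p.2]
    change _ + (commutatorRow x E β p ᵥ* x) q - _ = _
    rw [Pi.add_apply]
    ring
  -- Here the two exceptional rows coincide, and no condition is left.
  by_cases hn : n = 0
  · refine ⟨Matrix.of fun k => commutatorRow x E 0 k,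
      fun p q => commutatorRow_mem hE (fun _ => J.zero_mem) p q, fun p q h => ?_⟩
    exact hinner 0 p q h.1 fun h' => h.1 (by omega)
  let l : Fin (m + 2 * n) := ⟨m + 2 * n - 1, by omega⟩
  let ξ₀ : Matrix (Fin (m + 2 * n)) (Fin (m + 2 * n)) R :=
    Matrix.of fun k : Fin (m + 2 * n) => commutatorRow x E 0 k
  have hξ₀ (p q) : ξ₀ p q ∈ J := commutatorRow_mem hE (fun _ => J.zero_mem) p q
  -- What remains is the last row in the columns n ≤ q < m + n, that is, m equations. With s = q -
  -- n, `t s` is minus the left-hand side obtained for β = 0.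
  let t (s : ℕ) : R := if h : s < m then -(E + ξ₀ * x - x * ξ₀) l ⟨s + n, by omega⟩ else 0
  have ht (s) : t s ∈ J := by
    simp only [t]
    split_ifs
    · refine J.neg_mem (J.sub_mem (J.add_mem (hE _ _) (vecMul_mem (hξ₀ _) x _)) ?_)
      rw [mul_apply]
      exact J.sum_mem fun k _ => J.mul_mem_left _ (hξ₀ _ _)
    · exact J.zero_mem
  -- β is supported on the first m coordinates, so that xᵏ with k ≤ n acts on it as a shift in
  -- columns q ≥ n. The equation in column q = s + n then reads γ(s) = t(s) + ∑ x l k · γ(q - (k -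
  -- (m + n))), summed over k ≥ m + n. As k - (m + n) < n, every index on the right exceeds s: the
  -- system is triangular.
  obtain ⟨γ, hγJ, hγ0, hγ⟩ := exists_backward_recurrence J m t ht
    (fun k : Fin (m + 2 * n) => if m + n ≤ k then x l k else 0)
    (fun k => n - (k - (m + n)) - 1)
  let β : Fin (m + 2 * n) → R := fun k => γ k
  have hβ (k : ℕ) (hk : k ≤ n) (q : Fin (m + 2 * n)) (hq : n ≤ q) :
      (β ᵥ* x ^ k) q = γ (q - k) := by
    rw [vecMul, dotProduct, Finset.sum_eq_single ⟨q - k, by omega⟩]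
    · by_cases h : (q : ℕ) - k < m
      · rw [pow_row_eq hx _ _ (by omega), if_pos (by omega), mul_one]
      · simp [β, hγ0 _ (not_lt.1 h)]
    · intro p _ hp
      by_cases h : (p : ℕ) < m
      · have := pow_row_eq hx p k (by omega) q
        rw [this, if_neg, mul_zero]
        intro h'
        apply hp
        ext
        simp only
        omega
      · simp [β, hγ0 _ (not_lt.1 h)]
    · simp
  refine ⟨Matrix.of fun k => commutatorRow x E β k,
    fun p q => commutatorRow_mem hE (fun _ => hγJ _) p q, fun p q h => ?_⟩
  by_cases hp : (p : ℕ) + 1 = m + 2 * n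
  · obtain rfl : p = l := Fin.ext (by simp only [l]; omega)
    have hq : n ≤ (q : ℕ) ∧ (q : ℕ) < m + n := by
      have := h.2
      omega
    have h₁ : commutatorRow x E β (l : ℕ) = β ᵥ* x ^ (n - 1) + ξ₀ l := by
      have hl : (l : ℕ) = m + n + (n - 1) := by simp only [l]; omega
      change _ = _ + commutatorRow x E 0 l
      rw [hl, commutatorRow_add (by omega)]
    have h₂ (k : Fin (m + 2 * n)) : commutatorRow x E β k q =
        ξ₀ k q + if m + n ≤ (k : ℕ) then γ (q - (k - (m + n))) else 0 := by
      split_ifs with hk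
      · have hk' : (k : ℕ) = m + n + (k - (m + n)) := by omega
        change _ = commutatorRow x E 0 k q + _
        rw [← hβ (k - (m + n)) (by omega) q hq.1]
        conv_lhs => rw [hk', commutatorRow_add (by omega)]
        conv_rhs => rw [hk']
        rw [add_comm]
        simp
      · rw [add_zero, commutatorRow_of_lt _ _ _ (not_le.1 hk)]; rfl
    have h₃ := hγ (q - n) (by omega)
    simp only [t] at h₃
    rw [dif_pos (by omega)] at h₃
    have hqn : (⟨(q : ℕ) - n + n, by omega⟩ : Fin (m + 2 * n)) = q := Fin.ext (by simp; omega)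
    rw [hqn, hrow] at h₃
    rw [hrow]
    have h₄ : (Matrix.of (fun k : Fin (m + 2 * n) => commutatorRow x E β k) l ᵥ* x) q =
        γ (q - n) + (ξ₀ l ᵥ* x) q := by
      change (commutatorRow x E β l ᵥ* x) q = _
      rw [h₁, add_vecMul, vecMul_vecMul, ← pow_succ, Nat.sub_add_cancel (by omega), Pi.add_apply,
        hβ n le_rfl q hq.1]
    have h₅ : (x l ᵥ* Matrix.of fun k : Fin (m + 2 * n) => commutatorRow x E β k) q =
        (x l ᵥ* ξ₀) q + ∑ k : Fin (m + 2 * n), (if m + n ≤ (k : ℕ) then x l k else 0) *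
          γ ((q : ℕ) - n + 1 + (n - (k - (m + n)) - 1)) := by
      simp only [vecMul, dotProduct, of_apply, h₂, mul_add, Finset.sum_add_distrib]
      congr 1
      refine Finset.sum_congr rfl fun k _ => ?_
      split_ifs with hk
      · congr 2; omega
      · simp
    rw [h₄, h₅, h₃]
    ring
  · exact hinner β p q h.1 hp

end Transversality

/-! ### Lifting points (g, y) across square-zero extensions. -/

variable {m n : ℕ}

theorem mul_eq_zero_of_entries_mem {R : Type} [CommRing R] {N : ℕ} {J : Ideal R}
    (hJ : J ^ 2 = ⊥) {M M' : Matrix (Fin N) (Fin N) R} (hM : ∀ p q, M p q ∈ J)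
    (hM' : ∀ p q, M' p q ∈ J) : M * M' = 0 := by
  ext p q
  rw [mul_apply]
  refine Finset.sum_eq_zero fun k _ => ?_
  have := Ideal.mul_mem_mul (hM p k) (hM' k q)
  rwa [← pow_two, hJ] at this

/-- The inverse is 2 - a, since (a - 1)² = 0. -/
theorem isUnit_of_map_eq_one {R R₀ : Type} [CommRing R] [CommRing R₀] {π : R →+* R₀}
    (hJ : RingHom.ker π ^ 2 = ⊥) {a : R} (ha : π a = 1) : IsUnit a := by
  have h : a - 1 ∈ RingHom.ker π := by rw [RingHom.mem_ker, map_sub, ha, map_one, sub_self]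
  have h' := Ideal.mul_mem_mul h h
  rw [← pow_two, hJ, Ideal.mem_bot] at h'
  exact IsUnit.of_mul_eq_one (2 - a) (by linear_combination -h')

/-- A matrix in the slice modulo a square-zero ideal can be moved into the slice by conjugation
with an invertible matrix congruent to `1`. -/
theorem exists_conj_isInSlice {R R₀ : Type} [CommRing R] [CommRing R₀] (π : R →+* R₀)
    (hJ : RingHom.ker π ^ 2 = ⊥)
    (x : Matrix (Fin (m + 2 * n)) (Fin (m + 2 * n)) R) (hx : x.trace = 0)
    (hπ : IsInSlice m n (x.map π)) :
    ∃ u : (Matrix (Fin (m + 2 * n)) (Fin (m + 2 * n)) R)ˣ, mapUnits π u = 1 ∧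
      IsInSlice m n ((u : Matrix _ _ R) * x * (↑u⁻¹ : Matrix _ _ R)) := by
  classical
  -- Only the fixed entries are corrected. The trace of x₀ may be nonzero, but the commutator lemma
  -- does not involve the trace, and the final trace condition comes from conjugating x itself.
  let x₀ : Matrix (Fin (m + 2 * n)) (Fin (m + 2 * n)) R := Matrix.of fun p q =>
    if IsFixedPosition m n p q then standardNilpotent m n R p q else x p q
  have hx₀ (p q) (h : IsFixedPosition m n p q) : x₀ p q = standardNilpotent m n R p q :=
    if_pos h
  have hE (p q) : (x - x₀) p q ∈ RingHom.ker π := by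
    by_cases h : IsFixedPosition m n p q
    · rw [Matrix.sub_apply, hx₀ p q h, RingHom.mem_ker, map_sub]
      have := hπ.2 p q h.1 h.2
      rw [map_apply] at this
      rw [this]
      simp only [standardNilpotent, of_apply]
      split_ifs <;> simp
    · have : x₀ p q = x p q := if_neg h
      rw [Matrix.sub_apply, this, sub_self]
      exact Ideal.zero_mem _
  obtain ⟨ξ, hξ, hξ'⟩ := exists_commutator_add_eq_zero hx₀ hE
  have hξξ : ξ * ξ = 0 := mul_eq_zero_of_entries_mem hJ hξ hξ
  have hξE : ξ * (x - x₀) = 0 := mul_eq_zero_of_entries_mem hJ hξ hE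
  have hEξ : (x - x₀) * ξ = 0 := mul_eq_zero_of_entries_mem hJ hE hξ
  have hξxξ : ξ * x * ξ = 0 := mul_eq_zero_of_entries_mem hJ (fun p q => vecMul_mem (hξ p) x q) hξ
  let u : (Matrix (Fin (m + 2 * n)) (Fin (m + 2 * n)) R)ˣ :=
    ⟨1 + ξ, 1 - ξ, by simp [mul_sub, add_mul, hξξ], by simp [sub_mul, mul_add, hξξ]⟩
  -- As J² = 0, x may be replaced by x₀ in products with ξ, and the quadratic term drops out.
  have hu : (u : Matrix _ _ R) * x * (↑u⁻¹ : Matrix _ _ R) = x₀ + ((x - x₀) + ξ * x₀ - x₀ * ξ) := by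
    change (1 + ξ) * x * (1 - ξ) = _
    have e₁ : ξ * x = ξ * x₀ := by rw [mul_sub, sub_eq_zero] at hξE; exact hξE
    have e₂ : x * ξ = x₀ * ξ := by rw [sub_mul, sub_eq_zero] at hEξ; exact hEξ
    have : (1 + ξ) * x * (1 - ξ) = x + ξ * x - x * ξ - ξ * x * ξ := by noncomm_ring
    rw [this, hξxξ, e₁, e₂]
    abel
  refine ⟨u, ?_, ?_, fun p q h₁ h₂ => ?_⟩
  · apply Units.ext
    rw [coe_mapUnits]
    change (1 + ξ).map π = 1
    ext p q
    have : π (ξ p q) = 0 := hξ p q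
    rw [map_apply, Matrix.add_apply, map_add, this, add_zero, one_apply, one_apply]
    split_ifs <;> simp
  · rw [trace_mul_cycle, Units.inv_mul, one_mul, hx]
  · rw [hu, Matrix.add_apply, hξ' p q ⟨h₁, h₂⟩, add_zero, hx₀ p q ⟨h₁, h₂⟩]

theorem mem_cotangentBundle_obj {N : ℕ} {R : CommAlgCat.{0} ℂ}
    (g : (Matrix (Fin N) (Fin N) R)ˣ) (y : Matrix (Fin N) (Fin N) R)
    (hy : ∀ p q, q ≤ p → y p q = 0) :
    ((flagOf g, (g : Matrix (Fin N) (Fin N) R) * y * (↑g⁻¹ : Matrix (Fin N) (Fin N) R)) :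
      Flag N R × Matrix (Fin N) (Fin N) R) ∈ (cotangentBundle N).obj R := by
  refine ⟨?_, fun j k hjk => ?_⟩
  · rw [trace_mul_cycle, Units.inv_mul, one_mul]
    exact Finset.sum_eq_zero fun i _ => hy i i le_rfl
  · exact (conj_mulVec_mem_columnSpan_iff g y j k).2 fun p q hp hq => hy p q (by
      rw [Fin.le_def]; omega)

theorem mem_overSlice_obj {R : CommAlgCat.{0} ℂ} (V : Flag (m + 2 * n) R)
    (x : Matrix (Fin (m + 2 * n)) (Fin (m + 2 * n)) R) (hx : IsInSlice m n x) :
    ((V, x) : Flag (m + 2 * n) R × Matrix (Fin (m + 2 * n)) (Fin (m + 2 * n)) R) ∈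
      (overSlice m n).obj R := hx

/-- The point of `U` given by the flag of columns of `g` and the matrix `g y g⁻¹`, where `y` is
strictly upper triangular. -/
noncomputable def point {R : CommAlgCat.{0} ℂ}
    (g : (Matrix (Fin (m + 2 * n)) (Fin (m + 2 * n)) R)ˣ)
    (y : Matrix (Fin (m + 2 * n)) (Fin (m + 2 * n)) R) (hy : ∀ p q, q ≤ p → y p q = 0)
    (hs : IsInSlice m n ((g : Matrix _ _ R) * y * (↑g⁻¹ : Matrix _ _ R))) : (U m n).obj R :=
  ⟨(flagOf g, (g : Matrix _ _ R) * y * (↑g⁻¹ : Matrix _ _ R)),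
    ⟨mem_cotangentBundle_obj g y hy, mem_overSlice_obj _ _ hs⟩⟩

theorem conj_map {A B : Type} [CommRing A] [CommRing B] {N : ℕ} (φ : A →+* B)
    (g : (Matrix (Fin N) (Fin N) A)ˣ) (y : Matrix (Fin N) (Fin N) A) :
    ((g : Matrix _ _ A) * y * (↑g⁻¹ : Matrix _ _ A)).map φ =
      (mapUnits φ g : Matrix _ _ B) * y.map φ * (↑(mapUnits φ g)⁻¹ : Matrix _ _ B) := by
  rw [Matrix.map_mul, Matrix.map_mul, coe_mapUnits, coe_inv_mapUnits]

theorem map_point {R R' : CommAlgCat.{0} ℂ} (φ : R ⟶ R')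
    (g : (Matrix (Fin (m + 2 * n)) (Fin (m + 2 * n)) R)ˣ)
    (y : Matrix (Fin (m + 2 * n)) (Fin (m + 2 * n)) R) (hy : ∀ p q, q ≤ p → y p q = 0)
    (hs : IsInSlice m n ((g : Matrix _ _ R) * y * (↑g⁻¹ : Matrix _ _ R)))
    (hy' : ∀ p q, q ≤ p → y.map φ.hom p q = 0)
    (hs' : IsInSlice m n ((mapUnits (φ.hom : R →+* R') g : Matrix _ _ R') * y.map φ.hom *
      (↑(mapUnits (φ.hom : R →+* R') g)⁻¹ : Matrix _ _ R'))) :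
    (U m n).map φ (point g y hy hs) = point (mapUnits (φ.hom : R →+* R') g) (y.map φ.hom) hy' hs' :=
  Subtype.ext (Prod.ext (flagOf_map (φ.hom : R →+* R') g) (conj_map (φ.hom : R →+* R') g y))

/-- In the adapted basis the condition concerns the entries of y in rows ≥ i - 1 and columns ≤ i;
all of these except one lie on or below the diagonal. -/
theorem point_mem_X_iff {R : CommAlgCat.{0} ℂ}
    (g : (Matrix (Fin (m + 2 * n)) (Fin (m + 2 * n)) R)ˣ)
    (y : Matrix (Fin (m + 2 * n)) (Fin (m + 2 * n)) R) (hy : ∀ p q, q ≤ p → y p q = 0)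
    (hs : IsInSlice m n ((g : Matrix _ _ R) * y * (↑g⁻¹ : Matrix _ _ R)))
    {i : ℕ} (hi : 0 < i) (hi' : i < m + 2 * n) :
    point g y hy hs ∈ (X m n i).obj R ↔ y ⟨i - 1, by omega⟩ ⟨i, hi'⟩ = 0 := by
  have : point g y hy hs ∈ (X m n i).obj R ↔ ∀ v ∈ columnSpan g (i + 1),
      ((g : Matrix _ _ R) * y * (↑g⁻¹ : Matrix _ _ R)) *ᵥ v ∈ columnSpan g (i - 1) := by
    constructor
    · intro h
      exact h ⟨i + 1, by omega⟩ ⟨i - 1, by omega⟩ rfl (by simp only; omega)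
    · intro h j k hj hk
      have hk' : (k : ℕ) = i - 1 := by omega
      change ∀ v ∈ columnSpan g j, _ ∈ columnSpan g k
      rw [hj, hk']
      exact h
  rw [this, conj_mulVec_mem_columnSpan_iff]
  constructor
  · intro h
    exact h _ _ le_rfl (Nat.lt_succ_self i)
  · intro h p q hp hq
    by_cases hpq : q ≤ p
    · exact hy p q hpq
    · rw [Fin.le_def] at hpq
      convert h using 2 <;> apply Fin.ext <;> simp only <;> omega

/-- A point `(g, y)` over a quotient by a square-zero ideal lifts, with prescribed lift of `y`. -/
theorem exists_point_lift {R R₀ : CommAlgCat.{0} ℂ} (π : R ⟶ R₀)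
    (hπ : Function.Surjective π.hom) (hJ : RingHom.ker (π.hom : R →+* R₀) ^ 2 = ⊥)
    (g : (Matrix (Fin (m + 2 * n)) (Fin (m + 2 * n)) R₀)ˣ)
    (y : Matrix (Fin (m + 2 * n)) (Fin (m + 2 * n)) R₀) (hy : ∀ p q, q ≤ p → y p q = 0)
    (hs : IsInSlice m n ((g : Matrix _ _ R₀) * y * (↑g⁻¹ : Matrix _ _ R₀)))
    (y' : Matrix (Fin (m + 2 * n)) (Fin (m + 2 * n)) R) (hy' : ∀ p q, q ≤ p → y' p q = 0)
    (hyy' : y'.map π.hom = y) :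
    ∃ g' hs', (U m n).map π (point g' y' hy' hs') = point g y hy hs := by
  have hσ (r : R₀) : π.hom (Function.surjInv hπ r) = r := Function.surjInv_eq hπ r
  let ρ : R →+* R₀ := π.hom
  -- An entrywise lift of g is invertible, because its determinant is a unit modulo a square-zero
  -- ideal.
  let G : Matrix (Fin (m + 2 * n)) (Fin (m + 2 * n)) R :=
    (g : Matrix _ _ R₀).map (Function.surjInv hπ)
  have hG : G.map ρ = g := by
    ext p q; exact hσ _
  have hGu : IsUnit G := by
    rw [isUnit_iff_isUnit_det]
    have h₁ : IsUnit (ρ G.det) := by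
      rw [RingHom.map_det, RingHom.mapMatrix_apply, hG]
      exact (isUnit_iff_isUnit_det _).1 g.isUnit
    obtain ⟨e, he⟩ := h₁.exists_right_inv
    refine isUnit_of_mul_isUnit_left (y := Function.surjInv hπ e) (isUnit_of_map_eq_one hJ ?_)
    rw [map_mul]
    refine Eq.trans ?_ he
    congr 1
    exact hσ e
  obtain ⟨g₁, hg₁⟩ := hGu
  have hg₁' : mapUnits ρ g₁ = g := by
    apply Units.ext
    rw [coe_mapUnits, hg₁, hG]
  have hmap : ((g₁ : Matrix _ _ R) * y' * (↑g₁⁻¹ : Matrix _ _ R)).map ρ =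
      (g : Matrix _ _ R₀) * y * (↑g⁻¹ : Matrix _ _ R₀) := by
    rw [conj_map, hg₁']
    congr 2
  obtain ⟨u, hu, hu'⟩ := exists_conj_isInSlice ρ hJ
    ((g₁ : Matrix _ _ R) * y' * (↑g₁⁻¹ : Matrix _ _ R))
    (mem_cotangentBundle_obj g₁ y' hy').1 (by rw [hmap]; exact hs)
  have hconj : (u : Matrix _ _ R) * ((g₁ : Matrix _ _ R) * y' * (↑g₁⁻¹ : Matrix _ _ R)) *
      (↑u⁻¹ : Matrix _ _ R) = (↑(u * g₁) : Matrix _ _ R) * y' * (↑(u * g₁)⁻¹ : Matrix _ _ R) := by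
    rw [_root_.mul_inv_rev, Units.val_mul, Units.val_mul]
    simp only [mul_assoc]
  rw [hconj] at hu'
  have hug : mapUnits ρ (u * g₁) = g := by
    have : mapUnits ρ (u * g₁) = mapUnits ρ u * mapUnits ρ g₁ := map_mul (Units.map _) _ _
    rw [this, hu, one_mul, hg₁']
  -- The correction u changes only the adapted basis, which is why y' can be prescribed.
  refine ⟨u * g₁, hu', ?_⟩
  subst hug hyy'
  exact map_point π _ _ _ _ _ _

/-! ### Translated big cells of the flag variety. -/

section Cells

variable {N : ℕ} {A B : Type} [CommRing A] [CommRing B]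

/-- The normal form of a basis adapted to a flag in the open cell translated by `w`. -/
def IsCellForm (w : Equiv.Perm (Fin N)) (g : Matrix (Fin N) (Fin N) A) : Prop :=
  ∀ k j, k ≤ j → g (w k) j = if k = j then 1 else 0

/-- The coordinate submodule complementary to the `j`-th step of the flags in the open cell
translated by `w`. -/
def cellComplement (A : Type) [CommRing A] (w : Equiv.Perm (Fin N)) (j : ℕ) :
    Submodule A (Fin N → A) where
  carrier := {v | ∀ k : Fin N, (k : ℕ) < j → v (w k) = 0}
  add_mem' {v u} hv hu k hk := by rw [Pi.add_apply, hv k hk, hu k hk, add_zero]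
  zero_mem' _ _ := rfl
  smul_mem' c v hv k hk := by rw [Pi.smul_apply, hv k hk, smul_zero]

theorem single_mem_cellComplement {w : Equiv.Perm (Fin N)} {j : ℕ} {k : Fin N} (h : j ≤ (k : ℕ)) :
    (Pi.single (w k) 1 : Fin N → A) ∈ cellComplement A w j := by
  intro l hl
  rw [Pi.single_eq_of_ne]
  intro h'
  have := w.injective h'
  omega

theorem mapSubmodule_cellComplement (φ : A →+* B) (w : Equiv.Perm (Fin N)) (j : ℕ) :
    mapSubmodule φ (cellComplement A w j) = cellComplement B w j := by
  apply le_antisymm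
  · refine Submodule.span_le.2 ?_
    rintro _ ⟨v, hv, rfl⟩ k hk
    change φ (v (w k)) = 0
    rw [hv k hk, map_zero]
  · intro v hv
    rw [pi_eq_sum_univ v]
    refine Submodule.sum_mem _ fun i _ => ?_
    obtain ⟨k, rfl⟩ := w.surjective i
    by_cases hk : (k : ℕ) < j
    · rw [hv k hk, zero_smul]; exact Submodule.zero_mem _
    · refine Submodule.smul_mem _ _ ?_
      convert comp_mem_mapSubmodule φ (single_mem_cellComplement (A := A) (w := w) (not_lt.1 hk))
        using 1
      ext l
      by_cases h : l = w k
      · subst h; simp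
      · simp [h, Ne.symm h]

theorem IsCellForm.map {w : Equiv.Perm (Fin N)} {g : Matrix (Fin N) (Fin N) A}
    (hg : IsCellForm w g) (φ : A →+* B) : IsCellForm w (g.map φ) := by
  intro k j h
  rw [map_apply, hg k j h]
  split_ifs <;> simp

/-- After its rows are permuted by w, g is lower unitriangular. -/
theorem IsCellForm.isUnit {w : Equiv.Perm (Fin N)} {g : Matrix (Fin N) (Fin N) A}
    (hg : IsCellForm w g) : IsUnit g := by
  have hdet : (g.submatrix w id).det = 1 := by
    rw [det_of_isLowerTriangular]
    · exact Finset.prod_eq_one fun i _ => by rw [submatrix_apply, id, hg i i le_rfl, if_pos rfl]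
    · intro i j h
      have h' : i < j := h
      rw [submatrix_apply, id, hg i j h'.le, if_neg h'.ne]
  have := (isUnit_iff_isUnit_det (g.submatrix w id)).2 (hdet ▸ isUnit_one)
  exact (isUnit_submatrix_equiv w (Equiv.refl _)).1 this

/-- Forward substitution: triangularity kills the coordinates of v in the basis g one after another.
-/
theorem eq_zero_of_mem_columnSpan {w : Equiv.Perm (Fin N)} {g : (Matrix (Fin N) (Fin N) A)ˣ}
    (hg : IsCellForm w (g : Matrix (Fin N) (Fin N) A)) {j : ℕ} {v : Fin N → A}
    (hv : v ∈ columnSpan g j) (hv' : v ∈ cellComplement A w j) : v = 0 := by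
  have key (k : ℕ) (hk : k < N) : ((↑g⁻¹ : Matrix (Fin N) (Fin N) A) *ᵥ v) ⟨k, hk⟩ = 0 := by
    induction k using Nat.strong_induction_on with
    | _ k ih =>
      by_cases hkj : j ≤ k
      · exact hv ⟨k, hk⟩ hkj
      · have h := hv' ⟨k, hk⟩ (not_le.1 hkj)
        rw [← mulVec_inv_mulVec g v, mulVec, dotProduct, Finset.sum_eq_single ⟨k, hk⟩] at h
        · rwa [hg _ _ le_rfl, if_pos rfl, one_mul] at h
        · intro l _ hl
          rcases lt_or_gt_of_ne hl with h' | h'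
          · rw [ih l h' l.2, mul_zero]
          · rw [hg _ _ (le_of_lt h'), if_neg hl.symm, zero_mul]
        · simp
  rw [← mulVec_inv_mulVec g v]
  have : (↑g⁻¹ : Matrix (Fin N) (Fin N) A) *ᵥ v = 0 := funext fun k => key k k.2
  rw [this, mulVec_zero]

/-- Back substitution: for k < j the basis vector at w k is column k of g minus a combination of
basis vectors at w l with l > k. -/
theorem columnSpan_sup_cellComplement {w : Equiv.Perm (Fin N)} {g : (Matrix (Fin N) (Fin N) A)ˣ}
    (hg : IsCellForm w (g : Matrix (Fin N) (Fin N) A)) (j : ℕ) :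
    columnSpan g j ⊔ cellComplement A w j = ⊤ := by
  have key (d : ℕ) (k : Fin N) (hk : N ≤ k + d) :
      (Pi.single (w k) 1 : Fin N → A) ∈ columnSpan g j ⊔ cellComplement A w j := by
    induction d generalizing k with
    | zero => omega
    | succ d ih =>
      by_cases hkj : j ≤ (k : ℕ)
      · exact Submodule.mem_sup_right (single_mem_cellComplement hkj)
      · have h₁ : (Pi.single (w k) 1 : Fin N → A) = (g : Matrix (Fin N) (Fin N) A).col k -
            ∑ l, (if k < l then (g : Matrix (Fin N) (Fin N) A) (w l) k else 0) •
              (Pi.single (w l) 1 : Fin N → A) := by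
          ext i
          obtain ⟨l, rfl⟩ := w.surjective i
          simp only [Pi.sub_apply, Finset.sum_apply, Pi.smul_apply, Pi.single_apply,
            w.injective.eq_iff, smul_eq_mul, mul_ite, mul_one, mul_zero, Finset.sum_ite_eq,
            Finset.mem_univ, if_true, col_apply]
          by_cases hl : k < l
          · rw [if_pos hl, sub_self, if_neg hl.ne']
          · rw [if_neg hl, sub_zero, hg l k (not_lt.1 hl)]
        rw [h₁]
        refine Submodule.sub_mem _ (Submodule.mem_sup_left (col_mem_columnSpan g (not_le.1 hkj)))
          (Submodule.sum_mem _ fun l _ => ?_)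
        split_ifs with hl
        · exact Submodule.smul_mem _ _ (ih l (by omega))
        · rw [zero_smul]; exact Submodule.zero_mem _
  rw [eq_top_iff]
  intro v _
  rw [pi_eq_sum_univ' v]
  refine Submodule.sum_mem _ fun i _ => Submodule.smul_mem _ _ ?_
  obtain ⟨k, rfl⟩ := w.surjective i
  convert key N k (by omega) using 1

/-- The difference of the two j-th columns lies both in a step of the flag and in its complement,
because the normal form fixes the entries in the first j + 1 rows of the w-order. -/
theorem IsCellForm.ext_of_columnSpan_eq {w : Equiv.Perm (Fin N)}
    {g g' : (Matrix (Fin N) (Fin N) A)ˣ} (hg : IsCellForm w (g : Matrix (Fin N) (Fin N) A))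
    (hg' : IsCellForm w (g' : Matrix (Fin N) (Fin N) A))
    (h : ∀ j : Fin N, columnSpan g (j + 1) = columnSpan g' (j + 1)) : g = g' := by
  apply Units.ext
  ext i j
  have h₁ := col_mem_columnSpan g' (Nat.lt_succ_self j)
  rw [Nat.succ_eq_add_one, ← h j] at h₁
  have h₂ := eq_zero_of_mem_columnSpan hg
    (Submodule.sub_mem _ (col_mem_columnSpan g (Nat.lt_succ_self j)) h₁) (by
      intro k hk
      have hkj : k ≤ j := by rw [Fin.le_def]; omega
      simp only [Pi.sub_apply, col_apply]
      rw [hg k j hkj, hg' k j hkj, sub_self])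
  exact sub_eq_zero.1 (congrFun h₂ i)

/-- A step of a flag that spans together with the coordinate submodule is complementary to it. -/
theorem disjoint_cellComplement {w : Equiv.Perm (Fin N)} (j : ℕ) (hj : j ≤ N)
    (V : Module.Grassmannian A (Fin N → A) (N - j))
    (h : V.toSubmodule ⊔ cellComplement A w j = ⊤) :
    Disjoint V.toSubmodule (cellComplement A w j) := by
  let ι : (Fin (N - j) → A) →ₗ[A] (Fin N → A) :=
    Fintype.linearCombination A fun k : Fin (N - j) =>
      (Pi.single (w ⟨j + k, by omega⟩) 1 : Fin N → A)
  have hι (v) (hv : v ∈ cellComplement A w j) : ∃ c, ι c = v := by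
    refine ⟨fun k => v (w ⟨j + k, by omega⟩), ?_⟩
    ext i
    obtain ⟨l, rfl⟩ := w.surjective i
    simp only [ι, Fintype.linearCombination_apply, Finset.sum_apply, Pi.smul_apply,
      Pi.single_apply, w.injective.eq_iff, smul_eq_mul, mul_ite, mul_one, mul_zero]
    by_cases hl : (l : ℕ) < j
    · rw [hv l hl]
      refine Finset.sum_eq_zero fun k _ => if_neg ?_
      intro h'
      have := congrArg Fin.val h'
      simp only at this
      omega
    · rw [Finset.sum_eq_single ⟨l - j, by omega⟩]
      · have : (⟨j + (l - j), by omega⟩ : Fin N) = l := Fin.ext (by simp only; omega)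
        simp [this]
      · intro k _ hk
        refine if_neg fun h' => hk (Fin.ext ?_)
        have := congrArg Fin.val h'
        simp only at this ⊢
        omega
      · simp
  -- The complement is free of rank N - j and maps onto the quotient by V, which is projective of
  -- the same rank; such a surjection is injective.
  have hsurj : Function.Surjective (V.toSubmodule.mkQ ∘ₗ ι) := by
    intro q
    obtain ⟨v, rfl⟩ := V.toSubmodule.mkQ_surjective q
    obtain ⟨u, hu, e, he, rfl⟩ := Submodule.mem_sup.1 (h ▸ Submodule.mem_top (x := v))
    obtain ⟨c, rfl⟩ := hι e he
    refine ⟨c, ?_⟩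
    rw [map_add, LinearMap.comp_apply, Submodule.mkQ_apply, Submodule.mkQ_apply,
      (Submodule.Quotient.mk_eq_zero _).2 hu, zero_add]
  have hbij := Module.bijective_of_surjective_of_rankAtStalk_eq hsurj fun p _ => by
    rw [V.rankAtStalk_eq]
    have : Nontrivial A := PrimeSpectrum.nontrivial ⟨p, inferInstance⟩
    simp
  rw [Submodule.disjoint_def]
  intro v hv hv'
  obtain ⟨c, rfl⟩ := hι v hv'
  have : c = 0 := hbij.1 (by
    rw [map_zero]; exact (Submodule.Quotient.mk_eq_zero _).2 hv)
  rw [this, map_zero]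

/-- Column j is the component in the step j + 1 of the basis vector at w j, projected along the
complement. The span of the first j columns lies in step j, and both are complementary to the same
submodule, so they agree. -/
theorem Flag.exists_isCellForm {w : Equiv.Perm (Fin N)} (V : Flag N A)
    (h : ∀ j, (V.V j).toSubmodule ⊔ cellComplement A w j = ⊤) :
    ∃ g : (Matrix (Fin N) (Fin N) A)ˣ, IsCellForm w (g : Matrix (Fin N) (Fin N) A) ∧
      flagOf g = V := by
  have hcol (j : Fin N) : ∃ v ∈ (V.V j.succ).toSubmodule,
      ∀ k, k ≤ j → v (w k) = if k = j then 1 else 0 := by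
    obtain ⟨u, hu, e, he, hue⟩ := Submodule.mem_sup.1
      (h j.succ ▸ Submodule.mem_top (x := (Pi.single (w j) 1 : Fin N → A)))
    refine ⟨u, hu, fun k hk => ?_⟩
    have := congrFun hue (w k)
    rw [Pi.add_apply, he k (by rw [Fin.val_succ]; rw [Fin.le_def] at hk; omega), add_zero] at this
    rw [this, Pi.single_apply]
    simp only [w.injective.eq_iff]
  choose c hcV hcw using hcol
  have hg : IsCellForm w (Matrix.of fun i j => c j i) := fun k j hkj => hcw j k hkj
  obtain ⟨g, hg'⟩ := hg.isUnit
  rw [← hg'] at hg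
  refine ⟨g, hg, Flag.ext (funext fun j => Module.Grassmannian.ext ?_)⟩
  have hle : columnSpan g j ≤ (V.V j).toSubmodule := columnSpan_le fun k hk => by
    rw [hg']
    exact V.mono k.succ j (by rw [Fin.le_def, Fin.val_succ]; omega) (hcV k)
  refine le_antisymm hle fun v hv => ?_
  obtain ⟨u, hu, e, he, rfl⟩ := Submodule.mem_sup.1
    (columnSpan_sup_cellComplement hg j ▸ Submodule.mem_top (x := v))
  have he' : e ∈ (V.V j).toSubmodule := by
    have := Submodule.sub_mem _ hv (hle hu)
    rwa [add_sub_cancel_left] at this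
  have := (Submodule.disjoint_def.1 (disjoint_cellComplement j (by omega) (V.V j) (h j))) e he' he
  rw [this, add_zero]
  exact hu

end Cells

/-! ### Over a field the cells cover the flag variety. -/

section Field

variable {K : Type} [Field K] {N : ℕ}

theorem Flag.finrank_V (V : Flag N K) (j : Fin (N + 1)) :
    Module.finrank K (V.V j).toSubmodule = j := by
  have h := (V.V j).rankAtStalk_eq ⊥
  rw [Module.rankAtStalk_eq_finrank_of_free] at h
  have h' := (V.V j).toSubmodule.finrank_quotient_add_finrank
  rw [Module.finrank_fin_fun] at h'
  have h'' : Module.finrank K ((Fin N → K) ⧸ (V.V j).toSubmodule) = N - j := by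
    simpa using h
  omega

/-- The span of the standard basis vectors with indices `f k` for `k ≥ j`. -/
def tailSpan (K : Type) [Field K] (f : Fin N → Fin N) (j : ℕ) : Submodule K (Fin N → K) :=
  Submodule.span K (Set.range fun k : {k : Fin N // j ≤ (k : ℕ)} => Pi.single (f k) 1)

theorem card_subtype_le (j : ℕ) : Fintype.card {k : Fin N // j ≤ (k : ℕ)} = N - j := by
  rw [← Fintype.card_fin (N - j)]
  refine Fintype.card_congr ⟨fun k => ⟨k.1 - j, by have := k.2; omega⟩,
    fun k => ⟨⟨j + k, by omega⟩, by simp⟩, fun k => ?_, fun k => ?_⟩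
  · have := k.2
    ext; simp only; omega
  · ext; simp

/-- Greedy choice from the top of the flag downwards: at each step pick a standard basis vector
outside the sum of the current step and the span of the vectors already chosen. Distinctness of the
choices is then automatic. -/
theorem exists_perm_sup_cellComplement_eq_top (V : Flag N K) :
    ∃ w : Equiv.Perm (Fin N), ∀ j, (V.V j).toSubmodule ⊔ cellComplement K w j = ⊤ := by
  have key (d : ℕ) : ∃ f : Fin N → Fin N,
      (∀ a b : Fin N, N ≤ a + d → N ≤ b + d → f a = f b → a = b) ∧
      ∀ j : Fin (N + 1), N ≤ j + d → Disjoint (V.V j).toSubmodule (tailSpan K f j) := by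
    induction d with
    | zero =>
      refine ⟨id, fun a b h => by omega, fun j hj => ?_⟩
      have : tailSpan K (id : Fin N → Fin N) j = ⊥ := by
        rw [tailSpan, Submodule.span_eq_bot]
        rintro _ ⟨k, rfl⟩
        have := k.2
        omega
      rw [this]
      exact disjoint_bot_right
    | succ d ih =>
      obtain ⟨f, hf, hd⟩ := ih
      by_cases hN : N ≤ d
      · exact ⟨f, fun a b _ _ => hf a b (by omega) (by omega), fun j _ => hd j (by omega)⟩
      let r : Fin N := ⟨N - d - 1, by omega⟩
      -- The dimension is at most r + (N - r - 1) < N.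
      have hne : (V.V r.castSucc).toSubmodule ⊔ tailSpan K f (r + 1) ≠ ⊤ := by
        intro h
        have h₁ := Submodule.finrank_add_le_finrank_add_finrank (V.V r.castSucc).toSubmodule
          (tailSpan K f (r + 1))
        have h₂ : Module.finrank K (tailSpan K f (r + 1)) ≤ N - (r + 1) := by
          rw [← card_subtype_le (N := N)]
          exact finrank_range_le_card _
        rw [h, finrank_top, Module.finrank_fin_fun, V.finrank_V, Fin.val_castSucc] at h₁
        omega
      obtain ⟨i, hi⟩ : ∃ i, (Pi.single i 1 : Fin N → K) ∉
          (V.V r.castSucc).toSubmodule ⊔ tailSpan K f (r + 1) := by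
        by_contra! hall
        apply hne
        rw [eq_top_iff, ← (Pi.basisFun K (Fin N)).span_eq, Submodule.span_le]
        rintro _ ⟨i, rfl⟩
        rw [Pi.basisFun_apply]
        exact hall i
      have hup (k : Fin N) (hk : (r : ℕ) + 1 ≤ k) : Function.update f r i k = f k :=
        Function.update_of_ne (fun h => by rw [h] at hk; omega) _ _
      have htail (j : ℕ) (hj : (r : ℕ) + 1 ≤ j) :
          tailSpan K (Function.update f r i) j = tailSpan K f j := by
        rw [tailSpan, tailSpan]
        congr 2
        ext1 k
        rw [hup _ (hj.trans k.2)]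
      have hfi (k : Fin N) (hk : (r : ℕ) + 1 ≤ k) : f k ≠ i := by
        rintro rfl
        exact hi (Submodule.mem_sup_right (Submodule.subset_span ⟨⟨k, hk⟩, rfl⟩))
      refine ⟨Function.update f r i, fun a b ha hb hab => ?_, fun j hj => ?_⟩
      · have hr : (r : ℕ) = N - d - 1 := rfl
        rcases eq_or_ne a r with rfl | ha' <;> rcases eq_or_ne b r with rfl | hb'
        · rfl
        · rw [Function.update_self, hup b (by omega)] at hab
          exact (hfi b (by omega) hab.symm).elim
        · rw [Function.update_self, hup a (by omega)] at hab
          exact (hfi a (by omega) hab).elim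
        · rw [hup a (by omega), hup b (by omega)] at hab
          exact hf a b (by omega) (by omega) hab
      · have hr : (r : ℕ) = N - d - 1 := rfl
        by_cases hjr : (r : ℕ) + 1 ≤ j
        · rw [htail j hjr]
          exact hd j (by omega)
        obtain rfl : j = r.castSucc := Fin.ext (by rw [Fin.val_castSucc]; omega)
        have hle : tailSpan K (Function.update f r i) r.castSucc ≤
            Submodule.span K {Pi.single i 1} ⊔ tailSpan K f (r + 1) := by
          refine Submodule.span_le.2 ?_
          rintro _ ⟨k, rfl⟩
          by_cases hk : (r : ℕ) + 1 ≤ k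
          · refine Submodule.mem_sup_right (Submodule.subset_span ⟨⟨k, hk⟩, ?_⟩)
            simp only [hup k hk]
          · have hkr : (k : Fin N) = r := Fin.ext (by
              have : (r : ℕ) ≤ k := k.2
              omega)
            refine Submodule.mem_sup_left ?_
            simp only [hkr, Function.update_self]
            exact Submodule.mem_span_singleton_self _
        rw [Submodule.disjoint_def]
        intro v hv hv'
        obtain ⟨u, hu, e, he, rfl⟩ := Submodule.mem_sup.1 (hle hv')
        obtain ⟨c, rfl⟩ := Submodule.mem_span_singleton.1 hu
        by_cases hc : c = 0
        · subst hc
          rw [zero_smul, zero_add] at hv ⊢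
          refine Submodule.disjoint_def.1 (hd r.succ (by rw [Fin.val_succ]; omega)) e
            (V.mono _ _ (Fin.castSucc_le_succ r) hv) ?_
          rwa [Fin.val_succ]
        · exfalso
          apply hi
          have h₁ : (Pi.single i 1 : Fin N → K) =
              c⁻¹ • (c • Pi.single i 1 + e) + -(c⁻¹ • e) := by
            rw [smul_add, smul_smul, inv_mul_cancel₀ hc, one_smul, add_neg_cancel_right]
          rw [h₁]
          exact Submodule.add_mem_sup (Submodule.smul_mem _ _ hv)
            (Submodule.neg_mem _ (Submodule.smul_mem _ _ he))
  obtain ⟨f, hf, hd⟩ := key N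
  have hinj : Function.Injective f := fun a b h => hf a b (by omega) (by omega) h
  let w : Equiv.Perm (Fin N) := Equiv.ofBijective f (Finite.injective_iff_bijective.1 hinj)
  refine ⟨w, fun j => ?_⟩
  have htop : (V.V j).toSubmodule ⊔ tailSpan K f j = ⊤ := by
    refine Submodule.eq_top_of_disjoint _ _ ?_ (hd j (by omega))
    have hli : LinearIndependent K
        fun k : {k : Fin N // (j : ℕ) ≤ k} => (Pi.single (f k) 1 : Fin N → K) := by
      have := (Pi.basisFun K (Fin N)).linearIndependent.comp
        (fun k : {k : Fin N // (j : ℕ) ≤ k} => f k) (hinj.comp Subtype.val_injective)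
      convert this using 1
      ext1 k
      simp
    rw [V.finrank_V, tailSpan, finrank_span_eq_card hli, card_subtype_le, Module.finrank_fin_fun]
    omega
  rw [eq_top_iff, ← htop]
  refine sup_le_sup_left (Submodule.span_le.2 ?_) _
  rintro _ ⟨k, rfl⟩
  exact single_mem_cellComplement (w := w) k.2

end Field

/-! ### The affine charts of `U` indexed by permutations. -/

section CellChart

/-- The equations on matrices `g`, `h`, `y` expressing that `g` is in the normal form of the cell
`w`, that `h` is its inverse, and that `(g, y)` defines a point of `U`. -/
structure IsCellPoint (w : Equiv.Perm (Fin (m + 2 * n))) {R : Type} [CommRing R]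
    (g h y : Matrix (Fin (m + 2 * n)) (Fin (m + 2 * n)) R) : Prop where
  cell : IsCellForm w g
  mul_eq_one : g * h = 1
  upper : ∀ p q, q ≤ p → y p q = 0
  slice : ∀ p q, IsFixedPosition m n p q → (g * y * h) p q = standardNilpotent m n R p q

/-- The polynomial ring in the entries of three matrices. -/
abbrev MatrixTripleRing (N : ℕ) : Type := MvPolynomial (Fin 3 × Fin N × Fin N) ℂ

/-- The generic matrices. -/
noncomputable def genericMatrix (N : ℕ) (i : Fin 3) :
    Matrix (Fin N) (Fin N) (MatrixTripleRing N) :=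
  Matrix.of fun p q => MvPolynomial.X (i, p, q)

/-- The polynomial equations of `IsCellPoint`. -/
def cellEquations (w : Equiv.Perm (Fin (m + 2 * n))) : Set (MatrixTripleRing (m + 2 * n)) :=
  let g := genericMatrix (m + 2 * n) 0
  let h := genericMatrix (m + 2 * n) 1
  let y := genericMatrix (m + 2 * n) 2
  {f | (∃ k j, k ≤ j ∧ f = g (w k) j - if k = j then 1 else 0) ∨
    (∃ i j, f = (g * h) i j - (1 : Matrix _ _ (MatrixTripleRing (m + 2 * n))) i j) ∨
    (∃ p q, q ≤ p ∧ f = y p q) ∨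
    ∃ p q, IsFixedPosition m n p q ∧
      f = (g * y * h) p q - standardNilpotent m n (MatrixTripleRing (m + 2 * n)) p q}

theorem standardNilpotent_map {R R' : Type} [CommRing R] [CommRing R'] (ψ : R →+* R')
    (p q : Fin (m + 2 * n)) :
    ψ (standardNilpotent m n R p q) = standardNilpotent m n R' p q := by
  simp only [standardNilpotent, of_apply]
  split_ifs <;> simp

theorem map_cellEquations_iff (w : Equiv.Perm (Fin (m + 2 * n))) {R : Type} [CommRing R]
    (ψ : MatrixTripleRing (m + 2 * n) →+* R) :
    (∀ f ∈ cellEquations w, ψ f = 0) ↔ IsCellPoint w ((genericMatrix _ 0).map ψ)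
      ((genericMatrix _ 1).map ψ) ((genericMatrix _ 2).map ψ) := by
  constructor
  · intro h
    refine ⟨fun k j hkj => ?_, ?_, fun p q hpq => ?_, fun p q hpq => ?_⟩
    · have := h _ (Or.inl ⟨k, j, hkj, rfl⟩)
      rw [map_sub, sub_eq_zero] at this
      rw [map_apply, this]
      split_ifs <;> simp
    · rw [← Matrix.map_mul]
      ext i j
      have := h _ (Or.inr (Or.inl ⟨i, j, rfl⟩))
      rw [map_sub, sub_eq_zero] at this
      rw [map_apply, this, one_apply, one_apply]
      split_ifs <;> simp
    · exact h _ (Or.inr (Or.inr (Or.inl ⟨p, q, hpq, rfl⟩)))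
    · have := h _ (Or.inr (Or.inr (Or.inr ⟨p, q, hpq, rfl⟩)))
      rw [map_sub, sub_eq_zero] at this
      rw [← Matrix.map_mul, ← Matrix.map_mul, map_apply, this, standardNilpotent_map]
  · rintro ⟨h₁, h₂, h₃, h₄⟩ f (⟨k, j, hkj, rfl⟩ | ⟨i, j, rfl⟩ | ⟨p, q, hpq, rfl⟩ | ⟨p, q, hpq, rfl⟩)
    · have := h₁ k j hkj
      rw [map_apply] at this
      rw [map_sub, this]
      split_ifs <;> simp
    · rw [← Matrix.map_mul] at h₂
      have := congrFun (congrFun h₂ i) j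
      rw [map_apply] at this
      rw [map_sub, this, one_apply, one_apply]
      split_ifs <;> simp
    · exact h₃ p q hpq
    · have := h₄ p q hpq
      rw [← Matrix.map_mul, ← Matrix.map_mul, map_apply] at this
      rw [map_sub, this, standardNilpotent_map, sub_self]

/-- The coordinate ring of the chart of `U` given by the cell `w`. -/
noncomputable def cellAlgebra (w : Equiv.Perm (Fin (m + 2 * n))) : CommAlgCat.{0} ℂ :=
  CommAlgCat.of ℂ (MatrixTripleRing (m + 2 * n) ⧸ Ideal.span (cellEquations w))

/-- The projection from the polynomial ring to the coordinate ring of the chart. -/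
noncomputable def cellProj (w : Equiv.Perm (Fin (m + 2 * n))) :
    MatrixTripleRing (m + 2 * n) →ₐ[ℂ] cellAlgebra w :=
  Ideal.Quotient.mkₐ ℂ (Ideal.span (cellEquations w))

theorem cellProj_surjective (w : Equiv.Perm (Fin (m + 2 * n))) :
    Function.Surjective (cellProj w) :=
  Ideal.Quotient.mkₐ_surjective ℂ _

/-- The universal matrices over the coordinate ring of the chart. -/
noncomputable def cellMatrix (w : Equiv.Perm (Fin (m + 2 * n))) (i : Fin 3) :
    Matrix (Fin (m + 2 * n)) (Fin (m + 2 * n)) (cellAlgebra w) :=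
  (genericMatrix (m + 2 * n) i).map (cellProj w)

theorem isCellPoint_cellMatrix (w : Equiv.Perm (Fin (m + 2 * n))) :
    IsCellPoint w (cellMatrix w 0) (cellMatrix w 1) (cellMatrix w 2) :=
  (map_cellEquations_iff w (cellProj w : MatrixTripleRing (m + 2 * n) →+* cellAlgebra w)).1
    fun _ hf => Ideal.Quotient.eq_zero_iff_mem.2 (Ideal.subset_span hf)

theorem exists_hom_of_isCellPoint {w : Equiv.Perm (Fin (m + 2 * n))} {R : CommAlgCat.{0} ℂ}
    {g h y : Matrix (Fin (m + 2 * n)) (Fin (m + 2 * n)) R} (H : IsCellPoint w g h y) :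
    ∃ φ : cellAlgebra w ⟶ R, (cellMatrix w 0).map φ.hom = g ∧ (cellMatrix w 1).map φ.hom = h ∧
      (cellMatrix w 2).map φ.hom = y := by
  let ψ : MatrixTripleRing (m + 2 * n) →ₐ[ℂ] R :=
    MvPolynomial.aeval fun i => (![g, h, y] i.1) i.2.1 i.2.2
  have hψ (i : Fin 3) : (genericMatrix _ i).map ψ = ![g, h, y] i := by
    ext p q
    simp [ψ, genericMatrix]
  have hker : ∀ f ∈ cellEquations w, ψ f = 0 :=
    (map_cellEquations_iff w (ψ : MatrixTripleRing (m + 2 * n) →+* R)).2 (by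
      change IsCellPoint w ((genericMatrix _ 0).map ψ) ((genericMatrix _ 1).map ψ)
        ((genericMatrix _ 2).map ψ)
      rw [hψ, hψ, hψ]
      exact H)
  let φ : cellAlgebra w ⟶ R := CommAlgCat.ofHom
    (Ideal.Quotient.liftₐ (Ideal.span (cellEquations w)) ψ fun f hf =>
      (Ideal.span_le.2 hker : Ideal.span (cellEquations w) ≤ RingHom.ker ψ) hf)
  have hφ (i : Fin 3) : (cellMatrix w i).map φ.hom = ![g, h, y] i := hψ i
  exact ⟨φ, hφ 0, hφ 1, hφ 2⟩

theorem cellAlgebra_hom_ext {w : Equiv.Perm (Fin (m + 2 * n))} {R : CommAlgCat.{0} ℂ}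
    {φ φ' : cellAlgebra w ⟶ R}
    (h : ∀ i, (cellMatrix w i).map φ.hom = (cellMatrix w i).map φ'.hom) : φ = φ' := by
  apply CommAlgCat.hom_ext
  have : φ.hom.comp (cellProj w) = φ'.hom.comp (cellProj w) :=
    MvPolynomial.algHom_ext fun i => congrFun (congrFun (h i.1) i.2.1) i.2.2
  apply AlgHom.ext
  intro a
  obtain ⟨f, rfl⟩ := cellProj_surjective w a
  exact DFunLike.congr_fun this f

/-- The universal invertible matrix over the coordinate ring of the chart. -/
noncomputable def cellUnit (w : Equiv.Perm (Fin (m + 2 * n))) :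
    (Matrix (Fin (m + 2 * n)) (Fin (m + 2 * n)) (cellAlgebra w))ˣ :=
  ⟨cellMatrix w 0, cellMatrix w 1, (isCellPoint_cellMatrix w).mul_eq_one,
    mul_eq_one_comm.1 (isCellPoint_cellMatrix w).mul_eq_one⟩

theorem isInSlice_conj {R : Type} [CommRing R]
    {g : (Matrix (Fin (m + 2 * n)) (Fin (m + 2 * n)) R)ˣ}
    {y : Matrix (Fin (m + 2 * n)) (Fin (m + 2 * n)) R} (hy : ∀ p q, q ≤ p → y p q = 0)
    (h : ∀ p q, IsFixedPosition m n p q →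
      ((g : Matrix _ _ R) * y * (↑g⁻¹ : Matrix (Fin (m + 2 * n)) (Fin (m + 2 * n)) R) :
        Matrix (Fin (m + 2 * n)) (Fin (m + 2 * n)) R) p q = standardNilpotent m n R p q) :
    IsInSlice m n ((g : Matrix _ _ R) * y * (↑g⁻¹ : Matrix _ _ R)) := by
  refine ⟨?_, fun p q h₁ h₂ => h p q ⟨h₁, h₂⟩⟩
  rw [trace_mul_cycle, Units.inv_mul, one_mul]
  exact Finset.sum_eq_zero fun i _ => hy i i le_rfl

/-- The chart of `U` given by the cell `w`. -/
noncomputable def cellPoint (w : Equiv.Perm (Fin (m + 2 * n))) : (U m n).obj (cellAlgebra w) :=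
  point (cellUnit w) (cellMatrix w 2) (isCellPoint_cellMatrix w).upper
    (isInSlice_conj (isCellPoint_cellMatrix w).upper (isCellPoint_cellMatrix w).slice)

theorem map_cellPoint (w : Equiv.Perm (Fin (m + 2 * n))) {R : CommAlgCat.{0} ℂ}
    (φ : cellAlgebra w ⟶ R) :
    ∃ hy hs, (U m n).map φ (cellPoint w) =
      point (mapUnits (φ.hom : cellAlgebra w →+* R) (cellUnit w)) ((cellMatrix w 2).map φ.hom)
        hy hs := by
  have hy : ∀ p q, q ≤ p → (cellMatrix w 2).map φ.hom p q = 0 := fun p q h => by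
    rw [map_apply, (isCellPoint_cellMatrix w).upper p q h, map_zero]
  refine ⟨hy, isInSlice_conj hy fun p q h => ?_, map_point φ _ _ _ _ _ _⟩
  have h' := standardNilpotent_map (φ.hom : cellAlgebra w →+* R) p q
  rw [← (isCellPoint_cellMatrix w).slice p q h] at h'
  rw [← h', coe_inv_mapUnits, coe_mapUnits]
  exact congrFun (congrFun (conj_map (φ.hom : cellAlgebra w →+* R) (cellUnit w)
    (cellMatrix w 2)).symm p) q

theorem isCellForm_map_cellUnit (w : Equiv.Perm (Fin (m + 2 * n))) {R : CommAlgCat.{0} ℂ}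
    (φ : cellAlgebra w ⟶ R) :
    IsCellForm w (mapUnits (φ.hom : cellAlgebra w →+* R) (cellUnit w) : Matrix _ _ R) :=
  (isCellPoint_cellMatrix w).cell.map (φ.hom : cellAlgebra w →+* R)

/-- The image of the chart is cut out by a condition on the flag alone: the normal form supplies g,
and y = g⁻¹ x g is strictly upper triangular because x lowers the flag. -/
theorem exists_map_cellPoint_iff (w : Equiv.Perm (Fin (m + 2 * n))) {R : CommAlgCat.{0} ℂ}
    (η : (U m n).obj R) : (∃ φ : cellAlgebra w ⟶ R, (U m n).map φ (cellPoint w) = η) ↔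
      ∀ j, (η.1.1.V j).toSubmodule ⊔ cellComplement R w j = ⊤ := by
  constructor
  · rintro ⟨φ, rfl⟩ j
    obtain ⟨hy, hs, h⟩ := map_cellPoint w φ
    rw [h]
    exact columnSpan_sup_cellComplement (isCellForm_map_cellUnit w φ) j
  · obtain ⟨⟨V, x⟩, hcot, hslice⟩ := η
    intro h
    obtain ⟨g, hg, hgV⟩ := Flag.exists_isCellForm V h
    obtain ⟨y, hgy⟩ : ∃ y : Matrix (Fin (m + 2 * n)) (Fin (m + 2 * n)) R,
        (g : Matrix _ _ R) * y * (↑g⁻¹ : Matrix _ _ R) = x :=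
      ⟨(↑g⁻¹ : Matrix _ _ R) * x * (g : Matrix _ _ R), by
        simp only [← mul_assoc, Units.mul_inv, one_mul]
        rw [mul_assoc, Units.mul_inv, mul_one]⟩
    subst hgy hgV
    have hy : ∀ p q, q ≤ p → y p q = 0 := by
      intro p q hqp
      exact (conj_mulVec_mem_columnSpan_iff g y _ _).1 (hcot.2 q.succ q.castSucc rfl) p q (by
        rw [Fin.val_castSucc]; exact hqp) (by rw [Fin.val_succ]; omega)
    have hcp : IsCellPoint w (g : Matrix _ _ R) (↑g⁻¹ : Matrix _ _ R) y :=
      ⟨hg, g.mul_inv, hy, fun p q hpq => hslice.2 p q hpq.1 hpq.2⟩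
    obtain ⟨φ, h₁, -, h₃⟩ := exists_hom_of_isCellPoint hcp
    refine ⟨φ, ?_⟩
    obtain ⟨hy', hs', h₄⟩ := map_cellPoint w φ
    obtain rfl : mapUnits (φ.hom : cellAlgebra w →+* R) (cellUnit w) = g := Units.ext h₁
    subst h₃
    exact h₄

theorem injective_map_cellPoint (w : Equiv.Perm (Fin (m + 2 * n))) (R : CommAlgCat.{0} ℂ) :
    Function.Injective fun φ : cellAlgebra w ⟶ R => (U m n).map φ (cellPoint w) := by
  intro φ φ' h
  obtain ⟨hy, hs, h₁⟩ := map_cellPoint w φ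
  obtain ⟨hy', hs', h₁'⟩ := map_cellPoint w φ'
  simp only [h₁, h₁'] at h
  have hg : mapUnits (φ.hom : cellAlgebra w →+* R) (cellUnit w) =
      mapUnits (φ'.hom : cellAlgebra w →+* R) (cellUnit w) := by
    refine IsCellForm.ext_of_columnSpan_eq (isCellForm_map_cellUnit w φ)
      (isCellForm_map_cellUnit w φ') fun j => ?_
    exact congrArg (fun η : (U m n).obj R => (η.1.1.V j.succ).toSubmodule) h
  have hx := congrArg (fun η : (U m n).obj R => η.1.2) h
  simp only [point, hg] at hx
  have hyy : (cellMatrix w 2).map φ.hom = (cellMatrix w 2).map φ'.hom :=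
    (Units.mul_right_inj _).1 ((Units.mul_left_inj _).1 hx)
  refine cellAlgebra_hom_ext fun i => ?_
  fin_cases i
  · exact congrArg Units.val hg
  · exact congrArg (fun u : (Matrix (Fin (m + 2 * n)) (Fin (m + 2 * n)) R)ˣ =>
      (↑u⁻¹ : Matrix (Fin (m + 2 * n)) (Fin (m + 2 * n)) R)) hg
  · exact hyy

theorem prod_ideal_eq_top_iff {R ι : Type*} [CommRing R] [Fintype ι] (I : ι → Ideal R) :
    ∏ j, I j = ⊤ ↔ ∀ j, I j = ⊤ := by
  constructor
  · intro h j
    rw [eq_top_iff, ← h]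
    exact Ideal.prod_le_inf.trans (Finset.inf_le (Finset.mem_univ j))
  · intro h
    rw [← Ideal.one_eq_top]
    exact Finset.prod_eq_one fun j _ => by rw [h j, Ideal.one_eq_top]

theorem isOpenChart_cellPoint (w : Equiv.Perm (Fin (m + 2 * n))) :
    PointFunctor.IsOpenChart (U m n) (cellAlgebra w) (cellPoint w) := by
  refine ⟨injective_map_cellPoint w, fun R η => ?_⟩
  -- The conditions for all steps j must hold together, and a product of ideals is the unit ideal
  -- exactly when every factor is.
  refine ⟨∏ j, minorIdeal ((η.1.1.V j).toSubmodule ⊔ cellComplement R w j), fun R' ψ => ?_⟩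
  have hprod : Ideal.map (ψ.hom : R →+* R')
      (∏ j, minorIdeal ((η.1.1.V j).toSubmodule ⊔ cellComplement R w j)) =
      ∏ j, Ideal.map (ψ.hom : R →+* R')
        (minorIdeal ((η.1.1.V j).toSubmodule ⊔ cellComplement R w j)) :=
    map_prod (Ideal.mapHom (ψ.hom : R →+* R')) _ _
  rw [exists_map_cellPoint_iff]
  refine Iff.trans ?_ (Iff.of_eq (congrArg (· = ⊤) hprod)).symm
  rw [prod_ideal_eq_top_iff]
  refine forall_congr' fun j => ?_
  have h := map_minorIdeal_eq_top_iff (ψ.hom : R →+* R')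
    ((η.1.1.V j).toSubmodule ⊔ cellComplement R w j)
  rw [mapSubmodule_sup, mapSubmodule_cellComplement] at h
  exact h.symm

theorem exists_map_cellPoint_of_isField {K : CommAlgCat.{0} ℂ} (hK : IsField K)
    (p : (U m n).obj K) :
    ∃ (w : Equiv.Perm (Fin (m + 2 * n))) (φ : cellAlgebra w ⟶ K),
      (U m n).map φ (cellPoint w) = p := by
  have key : ∀ (L : Type) (inst : CommRing L), IsField L → ∀ V : Flag (m + 2 * n) L,
      ∃ w : Equiv.Perm (Fin (m + 2 * n)),
        ∀ j, (V.V j).toSubmodule ⊔ cellComplement L w j = ⊤ := by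
    intro L inst hL V
    let F := hL.toField
    exact exists_perm_sup_cellComplement_eq_top (K := L) V
  obtain ⟨w, hw⟩ := key K _ hK p.1.1
  exact ⟨w, (exists_map_cellPoint_iff w p).2 hw⟩

end CellChart

end TwoBlock

/-! ### Infinitesimal lifting in open charts. -/

namespace PointFunctor

variable {F : CommAlgCat.{0} ℂ ⥤ Type} {A : CommAlgCat.{0} ℂ} {ξ : F.obj A}

/-- Open charts are stable under square-zero thickenings. -/
theorem IsOpenChart.exists_lift (h : IsOpenChart F A ξ) {R R₀ : CommAlgCat.{0} ℂ} (π : R ⟶ R₀)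
    (hπ : Function.Surjective π.hom) (hJ : RingHom.ker (π.hom : R →+* R₀) ^ 2 = ⊥)
    (η : F.obj R) (φ₀ : A ⟶ R₀) (h₀ : F.map φ₀ ξ = F.map π η) :
    ∃ φ : A ⟶ R, F.map φ ξ = η ∧ φ ≫ π = φ₀ := by
  obtain ⟨I, hI⟩ := h.2 R η
  have h₁ : I.map (π.hom : R →+* R₀) = ⊤ := (hI R₀ π).1 ⟨φ₀, h₀⟩
  obtain ⟨s, hs, hs'⟩ := (Ideal.mem_map_iff_of_surjective (π.hom : R →+* R₀) hπ).1
    (h₁ ▸ Submodule.mem_top (x := (1 : R₀)))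
  -- An element of I reducing to 1 is already a unit, so the open set contains the whole thickening.
  have hI' : I = ⊤ := Ideal.eq_top_of_isUnit_mem _ hs (TwoBlock.isUnit_of_map_eq_one hJ hs')
  obtain ⟨φ, hφ⟩ := (hI R (𝟙 R)).2 (by rw [hI', Ideal.map_top])
  have hφ' : F.map φ ξ = η := by rw [hφ, F.map_id]; rfl
  refine ⟨φ, hφ', h.1 R₀ ?_⟩
  simp only
  rw [F.map_comp, h₀, ← hφ']
  rfl

/-- A lift as a point of F is enough, since a thickening of a point of the chart stays in the chart.
-/
theorem IsOpenChart.formallySmooth (h : IsOpenChart F A ξ)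
    (hlift : ∀ (R R₀ : CommAlgCat.{0} ℂ) (π : R ⟶ R₀), Function.Surjective π.hom →
      RingHom.ker (π.hom : R →+* R₀) ^ 2 = ⊥ → ∀ φ₀ : A ⟶ R₀, ∃ η, F.map π η = F.map φ₀ ξ) :
    Algebra.FormallySmooth ℂ A := by
  refine Algebra.FormallySmooth.of_comp_surjective fun B _ _ I hI f => ?_
  let π : CommAlgCat.of ℂ B ⟶ CommAlgCat.of ℂ (B ⧸ I) :=
    CommAlgCat.ofHom (Ideal.Quotient.mkₐ ℂ I)
  let φ₀ : A ⟶ CommAlgCat.of ℂ (B ⧸ I) := CommAlgCat.ofHom f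
  have hπ : Function.Surjective π.hom := Ideal.Quotient.mkₐ_surjective ℂ I
  have hJ : RingHom.ker (π.hom : B →+* B ⧸ I) ^ 2 = ⊥ := by
    have : RingHom.ker (π.hom : B →+* B ⧸ I) = I := Ideal.mk_ker
    rw [this, hI]
  obtain ⟨η, hη⟩ := hlift _ _ π hπ hJ φ₀
  obtain ⟨φ, -, hφ⟩ := h.exists_lift π hπ hJ η φ₀ hη.symm
  exact ⟨φ.hom, congrArg CommAlgCat.Hom.hom hφ⟩

/-! ### Tangent vectors as points over the dual numbers. -/

section Tangent

variable {a : A ⟶ CommAlgCat.of ℂ ℂ}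

/-- The reduction modulo `ε`. -/
noncomputable def dualReduction :
    CommAlgCat.of ℂ (DualNumber ℂ) ⟶ CommAlgCat.of ℂ ℂ :=
  CommAlgCat.ofHom (TrivSqZeroExt.fstHom ℂ ℂ ℂ)

theorem dualReduction_hom_apply (r : DualNumber ℂ) :
    dualReduction.hom r = TrivSqZeroExt.fst r := rfl

theorem dualReduction_surjective : Function.Surjective dualReduction.hom := fun c =>
  ⟨TrivSqZeroExt.inl c, rfl⟩

theorem ker_dualReduction :
    RingHom.ker (dualReduction.hom : DualNumber ℂ →+* ℂ) ^ 2 = ⊥ := by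
  rw [eq_bot_iff, pow_two, Ideal.mul_le]
  intro r hr s hs
  have hr' : TrivSqZeroExt.fst r = 0 := hr
  have hs' : TrivSqZeroExt.fst s = 0 := hs
  rw [Ideal.mem_bot]
  ext <;> simp [hr', hs']

/-- The `ℂ[ε]`-point defined by a tangent vector. -/
noncomputable def dualHom {D : A →ₗ[ℂ] ℂ} (hD : D ∈ tangentSpace a) :
    A ⟶ CommAlgCat.of ℂ (DualNumber ℂ) :=
  have hD' : ∀ f g : A, D (f * g) = a.hom f * D g + a.hom g * D f := hD
  have h1 : D 1 = 0 := by simpa using hD' 1 1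
  CommAlgCat.ofHom
    { toFun := fun f => TrivSqZeroExt.inl (a.hom f) + TrivSqZeroExt.inr (D f)
      map_one' := by
        rw [h1, map_one, TrivSqZeroExt.inr_zero, add_zero]; rfl
      map_mul' := fun f g => by
        ext
        · simp
        · simp [hD' f g, mul_comm]
      map_zero' := by simp
      map_add' := fun f g => by
        ext <;> simp
      commutes' := fun c => by
        have h2 : D (algebraMap ℂ A c) = 0 := by
          rw [Algebra.algebraMap_eq_smul_one, map_smul, h1, smul_zero]
        have h3 : a.hom (algebraMap ℂ A c) = c := a.hom.commutes c
        rw [h2, h3, TrivSqZeroExt.inr_zero, add_zero]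
        rfl }

theorem dualHom_hom_apply {D : A →ₗ[ℂ] ℂ} (hD : D ∈ tangentSpace a) (f : A) :
    (dualHom hD).hom f = TrivSqZeroExt.inl (a.hom f) + TrivSqZeroExt.inr (D f) := rfl

theorem mem_tangentVectors_iff {D : A →ₗ[ℂ] ℂ} (hD : D ∈ tangentSpace a) (X : Subfunctor F) :
    D ∈ tangentVectors ξ a X ↔ F.map (dualHom hD) ξ ∈ X.obj _ := by
  constructor
  · rintro ⟨-, φ, hφ, hX⟩
    have : φ = dualHom hD := CommAlgCat.hom_ext (AlgHom.ext hφ)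
    rwa [← this]
  · intro h
    exact ⟨hD, dualHom hD, dualHom_hom_apply hD, h⟩

theorem exists_eq_dualHom (φ : A ⟶ CommAlgCat.of ℂ (DualNumber ℂ)) (hφ : φ ≫ dualReduction = a) :
    ∃ (D : A →ₗ[ℂ] ℂ) (hD : D ∈ tangentSpace a), φ = dualHom hD := by
  have hfst (f : A) : TrivSqZeroExt.fst (φ.hom f) = a.hom f := by rw [← hφ]; rfl
  let D : A →ₗ[ℂ] ℂ := (TrivSqZeroExt.sndHom ℂ ℂ) ∘ₗ φ.hom.toLinearMap
  have hDf (f : A) : D f = TrivSqZeroExt.snd (φ.hom f) := rfl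
  have hD : D ∈ tangentSpace a := by
    intro f g
    rw [hDf, map_mul, TrivSqZeroExt.snd_mul, hfst, hfst, hDf, hDf]
    simp [mul_comm]
  refine ⟨D, hD, CommAlgCat.hom_ext (AlgHom.ext fun f => ?_)⟩
  rw [dualHom_hom_apply, hDf, ← hfst]
  exact (TrivSqZeroExt.inl_fst_add_inr_snd_eq _).symm

/-- The tangent vectors to a closed subscheme which is locally defined by one equation (in some
chart) form the kernel of a linear functional (in every chart). -/
theorem exists_mem_tangentVectors_iff {X : Subfunctor F} {B : CommAlgCat.{0} ℂ} {ζ : F.obj B}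
    (hB : IsOpenChart F B ζ) {f : B}
    (hf : ∀ (R : CommAlgCat.{0} ℂ) (φ : B ⟶ R), F.map φ ζ ∈ X.obj R ↔ φ.hom f = 0)
    {b : B ⟶ CommAlgCat.of ℂ ℂ} (hab : F.map b ζ = F.map a ξ) (hbf : b.hom f = 0) :
    ∃ f' : A, ∀ D ∈ tangentSpace a, D ∈ tangentVectors ξ a X ↔ D f' = 0 := by
  let I : Ideal A := RingHom.ker (a.hom : A →+* ℂ)
  -- Tangent vectors at a factor through the first-order neighbourhood A / I², which lifts into the
  -- chart B. The equation f is pulled back to A / I² and then lifted to A, so the intersection of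
  -- the two charts is not needed.
  let R : CommAlgCat.{0} ℂ := CommAlgCat.of ℂ (A ⧸ I ^ 2)
  let q : A ⟶ R := CommAlgCat.ofHom (Ideal.Quotient.mkₐ ℂ (I ^ 2))
  have hq : Function.Surjective q.hom := Ideal.Quotient.mkₐ_surjective ℂ _
  let π : R ⟶ CommAlgCat.of ℂ ℂ := CommAlgCat.ofHom
    (Ideal.Quotient.liftₐ (I ^ 2) a.hom fun x hx => Ideal.pow_le_self two_ne_zero hx)
  have hqπ : q ≫ π = a := rfl
  have hπ : Function.Surjective π.hom := fun c => ⟨algebraMap ℂ R c, π.hom.commutes c⟩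
  have hJ : RingHom.ker (π.hom : R →+* ℂ) ^ 2 = ⊥ := by
    rw [eq_bot_iff, pow_two (RingHom.ker (π.hom : R →+* ℂ)), Ideal.mul_le]
    intro r hr s hs
    obtain ⟨r, rfl⟩ := hq r
    obtain ⟨s, rfl⟩ := hq s
    have hr' : r ∈ I := hr
    have hs' : s ∈ I := hs
    rw [Ideal.mem_bot, ← map_mul]
    exact Ideal.Quotient.eq_zero_iff_mem.2 (by rw [pow_two]; exact Ideal.mul_mem_mul hr' hs')
  obtain ⟨β, hβ, hβπ⟩ := hB.exists_lift π hπ hJ (F.map q ξ) b (by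
    rw [hab, ← hqπ, F.map_comp]; rfl)
  obtain ⟨f', hf'⟩ := hq (β.hom f)
  refine ⟨f', fun D hD => ?_⟩
  have haf' : a.hom f' = 0 := by
    rw [← hbf, ← hβπ]
    exact congrArg π.hom hf'
  let δ : R ⟶ CommAlgCat.of ℂ (DualNumber ℂ) := CommAlgCat.ofHom
    (Ideal.Quotient.liftₐ (I ^ 2) (dualHom hD).hom fun x hx => by
      have hle : I ^ 2 ≤ RingHom.ker ((dualHom hD).hom : A →+* DualNumber ℂ) := by
        rw [pow_two, Ideal.mul_le]
        intro r hr s hs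
        have hr' : a.hom r = 0 := hr
        have hs' : a.hom s = 0 := hs
        rw [RingHom.mem_ker]
        change (dualHom hD).hom (r * s) = 0
        rw [map_mul, dualHom_hom_apply, dualHom_hom_apply, hr', hs']
        ext <;> simp
      exact hle hx)
  have hδ : q ≫ δ = dualHom hD := rfl
  have hmap : F.map (dualHom hD) ξ = F.map (β ≫ δ) ζ := by
    rw [← hδ, F.map_comp, F.map_comp]
    change F.map δ (F.map q ξ) = F.map δ (F.map β ζ)
    rw [hβ]
  have hval : (β ≫ δ).hom f = TrivSqZeroExt.inl (a.hom f') + TrivSqZeroExt.inr (D f') := by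
    change δ.hom (β.hom f) = _
    rw [← hf']
    rfl
  rw [mem_tangentVectors_iff hD, hmap, hf, hval, haf', TrivSqZeroExt.inl_zero, zero_add,
    ← TrivSqZeroExt.inr_zero, TrivSqZeroExt.inr_injective.eq_iff]

/-- The tangent space of X is the kernel of a functional that is nonzero on E, so subtracting a
multiple of E, which is tangent to Y, makes D tangent to X. -/
theorem exists_add_eq_of_notMem_tangentVectors {X Y : Subfunctor F} {f' : A}
    (hX : ∀ D ∈ tangentSpace a, D ∈ tangentVectors ξ a X ↔ D f' = 0)
    {g' : A} (hY : ∀ D ∈ tangentSpace a, D ∈ tangentVectors ξ a Y ↔ D g' = 0)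
    {E : A →ₗ[ℂ] ℂ} (hE : E ∈ tangentSpace a) (hEX : E ∉ tangentVectors ξ a X)
    (hEY : E ∈ tangentVectors ξ a Y) {D : A →ₗ[ℂ] ℂ} (hD : D ∈ tangentSpace a) :
    ∃ D₁ ∈ tangentVectors ξ a X, ∃ D₂ ∈ tangentVectors ξ a Y, D₁ + D₂ = D := by
  rw [hX E hE] at hEX
  rw [hY E hE] at hEY
  have hcE := (tangentSpace a).smul_mem (D f' / E f') hE
  refine ⟨D - (D f' / E f') • E, ?_, (D f' / E f') • E, ?_, sub_add_cancel _ _⟩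
  · rw [hX _ ((tangentSpace a).sub_mem hD hcE)]
    simp [hEX]
  · rw [hY _ hcE]
    simp [hEY]

end Tangent

end PointFunctor

/-! ### Smoothness of the charts and the transverse tangent vectors. -/

namespace TwoBlock

open PointFunctor

variable {m n : ℕ}

theorem smooth_cellAlgebra (w : Equiv.Perm (Fin (m + 2 * n))) :
    Algebra.Smooth ℂ (cellAlgebra w) := by
  have h₁ : Algebra.FormallySmooth ℂ (cellAlgebra w) := by
    refine (isOpenChart_cellPoint w).formallySmooth fun R R₀ π hπ hJ φ₀ => ?_
    obtain ⟨hy, hs, h⟩ := map_cellPoint w φ₀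
    -- Any lift of y that is strictly upper triangular will do.
    let y' : Matrix (Fin (m + 2 * n)) (Fin (m + 2 * n)) R := Matrix.of fun p q =>
      if q ≤ p then 0 else Function.surjInv hπ ((cellMatrix w 2).map φ₀.hom p q)
    obtain ⟨g', hs', h'⟩ := exists_point_lift π hπ hJ _ _ hy hs y'
      (fun p q hqp => if_pos hqp) (by
        ext p q
        rw [map_apply]
        by_cases hqp : q ≤ p
        · rw [hy p q hqp]
          simp [y', hqp]
        · simp only [y', of_apply, if_neg hqp]
          exact Function.surjInv_eq hπ _)
    exact ⟨_, h'.trans h.symm⟩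
  have h₂ : Algebra.FinitePresentation ℂ (cellAlgebra w) :=
    Algebra.FinitePresentation.quotient (IsNoetherian.noetherian _)
  exact ⟨h₁, h₂⟩

theorem map_cellPoint_mem_X_iff (w : Equiv.Perm (Fin (m + 2 * n))) {i : ℕ} (hi : 0 < i)
    (hi' : i < m + 2 * n) (R : CommAlgCat.{0} ℂ) (φ : cellAlgebra w ⟶ R) :
    (U m n).map φ (cellPoint w) ∈ (X m n i).obj R ↔
      φ.hom (cellMatrix w 2 ⟨i - 1, by omega⟩ ⟨i, hi'⟩) = 0 := by
  obtain ⟨hy, hs, h⟩ := map_cellPoint w φ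
  rw [h, point_mem_X_iff _ _ _ _ hi hi']
  rfl

theorem isField_complex : IsField (CommAlgCat.of ℂ ℂ) := Field.toIsField ℂ

/-- At a point of `X i` there is a tangent vector which is not tangent to `X i`, but is tangent to
all other `X j` through the point. -/
theorem exists_tangent_transverse {A : CommAlgCat.{0} ℂ} {ξ : (U m n).obj A}
    (hA : IsOpenChart (U m n) A ξ) (a : A ⟶ CommAlgCat.of ℂ ℂ) {i : ℕ} (hi : 0 < i)
    (hi' : i < m + 2 * n) :
    ∃ D ∈ tangentSpace a, D ∉ tangentVectors ξ a (X m n i) ∧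
      ∀ j, 0 < j → j < m + 2 * n → j ≠ i →
        (U m n).map a ξ ∈ (X m n j).obj (CommAlgCat.of ℂ ℂ) →
        D ∈ tangentVectors ξ a (X m n j) := by
  obtain ⟨w, b, hb⟩ := exists_map_cellPoint_of_isField isField_complex ((U m n).map a ξ)
  obtain ⟨hy, hs, h⟩ := map_cellPoint w b
  rw [hb] at h
  let y : Matrix (Fin (m + 2 * n)) (Fin (m + 2 * n)) ℂ := (cellMatrix w 2).map b.hom
  -- Only the superdiagonal entry that defines X i moves, with velocity 1; the entries defining the
  -- other divisors keep their values.
  let y' : Matrix (Fin (m + 2 * n)) (Fin (m + 2 * n)) (DualNumber ℂ) := Matrix.of fun p q =>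
    TrivSqZeroExt.inl (y p q) + TrivSqZeroExt.inr (if (p : ℕ) + 1 = i ∧ (q : ℕ) = i then 1 else 0)
  obtain ⟨g', hs', h'⟩ := exists_point_lift (R := CommAlgCat.of ℂ (DualNumber ℂ)) dualReduction
    dualReduction_surjective ker_dualReduction _ _ hy hs y'
    (fun p q hqp => by
      have h₁ : y p q = 0 := hy p q hqp
      have h₂ : ¬((p : ℕ) + 1 = i ∧ (q : ℕ) = i) := by rw [Fin.le_def] at hqp; omega
      simp [y', h₁, h₂])
    (by
      ext p q
      rw [map_apply, dualReduction_hom_apply]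
      simp only [y', of_apply, TrivSqZeroExt.fst_add, TrivSqZeroExt.fst_inl,
        TrivSqZeroExt.fst_inr, add_zero]
      rfl)
  obtain ⟨φ, hφ, hφa⟩ := hA.exists_lift dualReduction dualReduction_surjective ker_dualReduction
    _ a (h.trans h'.symm)
  obtain ⟨D, hD, rfl⟩ := exists_eq_dualHom φ hφa
  refine ⟨D, hD, ?_, fun j hj hj' hji hX => ?_⟩
  · rw [mem_tangentVectors_iff hD, hφ, point_mem_X_iff _ _ _ _ hi hi']
    intro h0
    have := congrArg TrivSqZeroExt.snd h0
    simp [y', Nat.sub_add_cancel hi] at this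
  · rw [mem_tangentVectors_iff hD, hφ, point_mem_X_iff _ _ _ _ hj hj']
    rw [h, point_mem_X_iff _ _ _ _ hj hj'] at hX
    have hX' : y ⟨j - 1, by omega⟩ ⟨j, hj'⟩ = 0 := hX
    simp [y', hX', hji]

end TwoBlock

theorem mainTheorem10 (m n : ℕ) :
    PointFunctor.IsSmooth (TwoBlock.U m n) ∧
    (∀ i : ℕ, 0 < i → i < m + 2 * n → PointFunctor.IsSmoothDivisor (TwoBlock.X m n i)) ∧
    (∀ i j : ℕ, 0 < i → i < m + 2 * n → 0 < j → j < m + 2 * n → i ≠ j →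
      PointFunctor.IntersectTransversely (TwoBlock.X m n i) (TwoBlock.X m n j)) := by
  refine ⟨fun K hK p => ?_, fun i hi hi' K hK p => ?_, fun i j hi hi' hj hj' hij A ξ hA a hX hY => ?_⟩
  · obtain ⟨w, φ, hφ⟩ := TwoBlock.exists_map_cellPoint_of_isField hK p
    exact ⟨_, _, TwoBlock.isOpenChart_cellPoint w, TwoBlock.smooth_cellAlgebra w, φ, hφ⟩
  · obtain ⟨w, φ, hφ⟩ := TwoBlock.exists_map_cellPoint_of_isField hK p
    refine ⟨_, _, TwoBlock.isOpenChart_cellPoint w, TwoBlock.smooth_cellAlgebra w, ⟨φ, hφ⟩,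
      _, TwoBlock.map_cellPoint_mem_X_iff w hi hi', fun a ha => ?_⟩
    obtain ⟨D, hD, hDX, -⟩ :=
      TwoBlock.exists_tangent_transverse (TwoBlock.isOpenChart_cellPoint w) a hi hi'
    -- If the differential of the local equation vanished on D, then D would be tangent to the
    -- divisor.
    refine ⟨D, hD, fun h0 => hDX ?_⟩
    rw [PointFunctor.mem_tangentVectors_iff hD, TwoBlock.map_cellPoint_mem_X_iff w hi hi',
      PointFunctor.dualHom_hom_apply, ha, h0]
    simp
  · intro D hD
    obtain ⟨E, hE, hEX, hEY⟩ := TwoBlock.exists_tangent_transverse hA a hi hi'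
    obtain ⟨w, b, hb⟩ := TwoBlock.exists_map_cellPoint_of_isField TwoBlock.isField_complex
      ((TwoBlock.U m n).map a ξ)
    -- The equation of the divisor is known in a cell chart; its linearization is carried over to
    -- the given chart A.
    have key (k : ℕ) (hk : 0 < k) (hk' : k < m + 2 * n)
        (hmem : (TwoBlock.U m n).map a ξ ∈ (TwoBlock.X m n k).obj (CommAlgCat.of ℂ ℂ)) :=
      PointFunctor.exists_mem_tangentVectors_iff (TwoBlock.isOpenChart_cellPoint w)
        (TwoBlock.map_cellPoint_mem_X_iff w hk hk') hb
        ((TwoBlock.map_cellPoint_mem_X_iff w hk hk' _ b).1 (hb ▸ hmem))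
    obtain ⟨f', hf'⟩ := key i hi hi' hX
    obtain ⟨g', hg'⟩ := key j hj hj' hY
    exact PointFunctor.exists_add_eq_of_notMem_tangentVectors hf' hg' hE hEX
      (hEY j hj hj' hij.symm hY) hD
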